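/- Let $k$ be an algebraically closed field of characteristic $2$ and let $X$ be a curve over $k$, i.e. an integral scheme, proper and smooth of dimension one over $k$, with function field $k(X)$. For $x\in X$ closed let $v_x$ be the normalized valuation at $x$. A rational function $f\in k(X)$, regarded as a morphism $X\to\mathbb{P}^1_k$, is \emph{pseudo-tame} at $x$ if, for a uniformizer $t$ of $\mathbb{P}^1_k$ at $f(x)$, there is $h\in\mathcal{O}_{X,x}$ such that $v_x(f^*t+h^4)$ is an odd number; it is pseudo-tame on an open set $U$ if it is so at every closed point of $U$. Let $\mathcal{H}=k(X)\setminus k(X)^2$. For $f,g\in\mathcal{H}$ write uniquely $f=f_0^4+f_1^4g+f_2^4g^2+f_3^4g^3$ with $f_i\in k(X)$ and put $$a(f,g)=\frac{(f_1^2f_3^2+f_2^4)\,g}{f_3^4g^2+f_1^4}\bmod k(X)^2\ \in\ k(X)/k(X)^2 .$$ Let $B_X=\mathcal{O}_X/\mathcal{O}_X^2$ (a sheaf of abelian groups). For a nonempty open $U$, $H^0(U,B_X)$ is identified with the set of elements of $k(X)/k(X)^2$ that have, at each closed point of $U$, a representative regular at that point. There are an open covering $(U_i)_{i\in I}$ of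 $X$ by nonempty open sets and $f_i\in k(X)$ such that $f_i$ is pseudo-tame on $U_i$ for every $i$. For each such choice the family $(a(f_i,f_j))_{i,j}$ is a Čech $1$-cocycle with values in $B_X$, and its class $\beta(X)\in H^1(X,B_X)$ does not depend on the choice. Moreover, the following are equivalent: (1) $\beta(X)=0$ in $H^1(X,B_X)$; (2) there is a rational function on $X$ that is pseudo-tame on all of $X$. Furthermore, for every $f\in\mathcal{H}$ and every $a\in k(X)/k(X)^2$ there is $g\in\mathcal{H}$ with $a(f,g)=a$. -/

import Mathlib

open AlgebraicGeometry CategoryTheory TopologicalSpace Opposite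

universe u

namespace PseudoTame

noncomputable section

/-! ### First cohomology of a presheaf of abelian groups on a topological space,
as the direct limit, over all open coverings ordered by refinement, of the first
Čech cohomology groups. -/

/-- An open covering of a topological space, indexed by an arbitrary type. -/
structure Covering (X : TopCat.{u}) : Type (u + 1) where
  /-- the index set -/
  I : Type u
  /-- the members -/
  U : I → Opens X
  exists_mem : ∀ x : X, ∃ i, x ∈ U i

namespace Covering

variable {X : TopCat.{u}}

/-- `φ` exhibits `V` as a refinement of `U`. -/
def IsRefinement (U V : Covering X) (φ : V.I → U.I) : Prop :=
  ∀ j, V.U j ≤ U.U (φ j)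

/-- `U ≤ V` means that `V` refines `U`. -/
instance : Preorder (Covering X) where
  le U V := ∃ φ : V.I → U.I, IsRefinement U V φ
  le_refl _ := ⟨id, fun _ => le_rfl⟩
  le_trans _ _ _ := fun ⟨φ, hφ⟩ ⟨ψ, hψ⟩ => ⟨φ ∘ ψ, fun j => (hψ j).trans (hφ _)⟩

/-- The covering by pairwise intersections. -/
def inter (U V : Covering X) : Covering X where
  I := U.I × V.I
  U q := U.U q.1 ⊓ V.U q.2
  exists_mem x :=
    let ⟨i, hi⟩ := U.exists_mem x
    let ⟨j, hj⟩ := V.exists_mem x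
    ⟨(i, j), hi, hj⟩

instance : IsDirectedOrder (Covering X) where
  directed U V :=
    ⟨U.inter V, ⟨Prod.fst, fun _ => inf_le_left⟩, ⟨Prod.snd, fun _ => inf_le_right⟩⟩

instance : Nonempty (Covering X) := ⟨⟨PUnit, fun _ => ⊤, fun _ => ⟨⟨⟩, trivial⟩⟩⟩

end Covering

section Cech

variable {X : TopCat.{u}} (F : TopCat.Presheaf AddCommGrpCat.{u} X)

/-- Restriction of sections. -/
def res {U V : Opens X} (h : V ≤ U) : F.obj (op U) →+ F.obj (op V) :=
  (F.map (homOfLE h).op).hom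

lemma res_res {U V W : Opens X} (h : V ≤ U) (h' : W ≤ V) (s : F.obj (op U)) :
    res F h' (res F h s) = res F (h'.trans h) s := by
  simp only [res, ← AddCommGrpCat.comp_apply, ← F.map_comp]
  rfl

lemma res_self {U : Opens X} (s : F.obj (op U)) : res F (le_refl U) s = s := by
  simp [res]

/-- Čech `1`-cocycles: families `s i j ∈ F(U i ∩ U j)` with `s j k - s i k + s i j = 0` on
`U i ∩ U j ∩ U k`. -/
def cocycles (U : Covering X) : AddSubgroup (∀ i j : U.I, F.obj (op (U.U i ⊓ U.U j))) where
  carrier := {s | ∀ i j k,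
    res F (show U.U i ⊓ U.U j ⊓ U.U k ≤ U.U j ⊓ U.U k from inf_le_inf_right _ inf_le_right) (s j k)
    - res F (show U.U i ⊓ U.U j ⊓ U.U k ≤ U.U i ⊓ U.U k from inf_le_inf_right _ inf_le_left) (s i k)
    + res F (show U.U i ⊓ U.U j ⊓ U.U k ≤ U.U i ⊓ U.U j from inf_le_left) (s i j) = 0}
  zero_mem' := fun i j k => by simp
  add_mem' := fun {s t} hs ht i j k => by
    have h := congrArg₂ (· + ·) (hs i j k) (ht i j k)
    simp only [Pi.add_apply, map_add, add_zero] at h ⊢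
    rw [← h]; abel
  neg_mem' := fun {s} hs i j k => by
    have h := congrArg Neg.neg (hs i j k)
    simp only [Pi.neg_apply, map_neg, neg_zero] at h ⊢
    rw [← h]; abel

/-- The Čech differential, sending `(t i)` to `(t j - t i)` on `U i ∩ U j`. -/
def coboundary (U : Covering X) : (∀ i : U.I, F.obj (op (U.U i))) →+ cocycles F U where
  toFun t := ⟨fun i j => res F inf_le_right (t j) - res F inf_le_left (t i), fun i j k => by
    simp only [map_sub, res_res]; abel⟩
  map_zero' := by ext i j; simp
  map_add' t t' := by
    ext i j
    simp only [Pi.add_apply, map_add, AddSubgroup.coe_add]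
    abel

/-- The first Čech cohomology group of a covering. -/
abbrev CechH1 (U : Covering X) : Type u := cocycles F U ⧸ (coboundary F U).range

/-- Pull-back of cocycles along a refinement. -/
def refineCocycles {U V : Covering X} (φ : V.I → U.I) (hφ : U.IsRefinement V φ) :
    cocycles F U →+ cocycles F V where
  toFun s := ⟨fun i j => res F (inf_le_inf (hφ i) (hφ j)) (s.1 (φ i) (φ j)), fun i j k => by
    have h := congrArg (res F (inf_le_inf (inf_le_inf (hφ i) (hφ j)) (hφ k)))
      (s.2 (φ i) (φ j) (φ k))
    simpa only [map_add, map_sub, map_zero, res_res] using h⟩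
  map_zero' := by ext i j; simp
  map_add' s t := by ext i j; simp

/-- The map induced by a refinement on first Čech cohomology groups. -/
def refineH1 {U V : Covering X} (φ : V.I → U.I) (hφ : U.IsRefinement V φ) :
    CechH1 F U →+ CechH1 F V :=
  QuotientAddGroup.map _ _ (refineCocycles F φ hφ) <| by
    rintro _ ⟨t, rfl⟩
    refine ⟨fun j => res F (hφ j) (t (φ j)), ?_⟩
    ext i j
    simp [refineCocycles, coboundary, res_res]

/-- The induced map does not depend on the choice of the map between the index sets. -/
lemma refineH1_eq {U V : Covering X} (φ ψ : V.I → U.I) (hφ : U.IsRefinement V φ)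
    (hψ : U.IsRefinement V ψ) : refineH1 F φ hφ = refineH1 F ψ hψ := by
  ext s
  refine (QuotientAddGroup.eq (s := (coboundary F V).range)).2 ?_
  refine ⟨fun j => res F (le_inf (hφ j) (hψ j)) (s.1 (φ j) (ψ j)), ?_⟩
  ext i j
  have h₁ := congrArg (res F (le_inf (le_inf (inf_le_left.trans (hφ i))
    (inf_le_right.trans (hφ j))) (inf_le_right.trans (hψ j)) :
      V.U i ⊓ V.U j ≤ U.U (φ i) ⊓ U.U (φ j) ⊓ U.U (ψ j))) (s.2 (φ i) (φ j) (ψ j))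
  have h₂ := congrArg (res F (le_inf (le_inf (inf_le_left.trans (hφ i))
    (inf_le_left.trans (hψ i))) (inf_le_right.trans (hψ j)) :
      V.U i ⊓ V.U j ≤ U.U (φ i) ⊓ U.U (ψ i) ⊓ U.U (ψ j))) (s.2 (φ i) (ψ i) (ψ j))
  simp only [map_add, map_sub, map_zero, res_res] at h₁ h₂
  simp only [refineCocycles, coboundary, AddMonoidHom.coe_mk, ZeroHom.coe_mk, res_res,
    AddSubgroup.coe_add, AddSubgroup.coe_neg, Pi.add_apply, Pi.neg_apply]
  rw [← sub_eq_zero]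
  have h := congrArg₂ (· - ·) h₁ h₂
  simp only [sub_zero] at h
  rw [← h]; abel

/-- The transition map `Ȟ¹(U, F) → Ȟ¹(V, F)` for a refinement `V` of `U`. -/
def transition (U V : Covering X) (h : U ≤ V) : CechH1 F U →+ CechH1 F V :=
  refineH1 F h.choose h.choose_spec

lemma transition_eq {U V : Covering X} (h : U ≤ V) (φ : V.I → U.I) (hφ : U.IsRefinement V φ) :
    transition F U V h = refineH1 F φ hφ :=
  refineH1_eq F _ _ _ _

instance : DirectedSystem (CechH1 F) (transition F · · ·) where
  map_self U x := by
    rw [transition_eq F _ id fun _ => le_rfl]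
    obtain ⟨s, rfl⟩ := QuotientAddGroup.mk_surjective x
    refine congrArg QuotientAddGroup.mk ?_
    ext i j
    exact res_self F _
  map_map W V U hij hjk x := by
    obtain ⟨φ, hφ⟩ := hij
    obtain ⟨ψ, hψ⟩ := hjk
    rw [transition_eq F _ φ hφ, transition_eq F _ ψ hψ,
      transition_eq F _ (φ ∘ ψ) fun j => (hψ j).trans (hφ _)]
    obtain ⟨s, rfl⟩ := QuotientAddGroup.mk_surjective x
    refine congrArg QuotientAddGroup.mk ?_
    ext i j
    exact res_res F _ _ _

/-- `H¹(X, F)`, the direct limit over all open coverings of the first Čech cohomology groups.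
It is an abelian group. -/
abbrev H1 : Type (u + 1) := DirectLimit (CechH1 F) (transition F)

/-- The class in `H¹(X, F)` of a Čech `1`-cocycle on an open covering. -/
def H1.mk (U : Covering X) (s : cocycles F U) : H1 F :=
  ⟦⟨U, QuotientAddGroup.mk s⟩⟧

end Cech

/-! ### The sheaf `B_X = 𝒪_X / 𝒪_X²` -/

/-- The additive group `R / R²`. The subgroup generated by the squares is the set of squares when
`R` has characteristic two. -/
abbrev ModSq (R : Type u) [CommRing R] : Type u :=
  R ⧸ AddSubgroup.closure (Set.range fun a : R => a ^ 2)

/-- The homomorphism `R / R² → S / S²` induced by a ring homomorphism `R → S`. -/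
def ModSq.map {R S : Type u} [CommRing R] [CommRing S] (φ : R →+* S) : ModSq R →+ ModSq S :=
  QuotientAddGroup.map _ _ φ.toAddMonoidHom <| by
    rw [AddSubgroup.closure_le]
    rintro _ ⟨a, rfl⟩
    exact AddSubgroup.subset_closure ⟨φ a, by simp⟩

/-- The class in `R / R²` of an element of `R`. -/
def ModSq.mk {R : Type u} [CommRing R] (a : R) : ModSq R := QuotientAddGroup.mk a

/-- Sections of `B_X` over `U`: families of elements of `𝒪_{X,x} / 𝒪_{X,x}²`, for `x ∈ U`, that
come locally from sections of `𝒪_X`. This is the sheaf associated with the presheaf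
`V ↦ Γ(X, V) / Γ(X, V)²`. -/
def bSections (X : Scheme.{u}) (U : X.Opens) :
    AddSubgroup (∀ x : U, ModSq (X.presheaf.stalk x.1)) where
  carrier := {s | ∀ x : U, ∃ (V : X.Opens) (hVU : V ≤ U) (_ : x.1 ∈ V) (h : Γ(X, V)),
    ∀ (y : X) (hy : y ∈ V), s ⟨y, hVU hy⟩ = ModSq.mk (X.presheaf.germ V y hy h)}
  zero_mem' x := ⟨U, le_rfl, x.2, 0, fun y hy => by simp [ModSq.mk]⟩
  add_mem' := fun {s t} hs ht x => by
    obtain ⟨V, hV, hxV, a, ha⟩ := hs x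
    obtain ⟨W, hW, hxW, b, hb⟩ := ht x
    refine ⟨V ⊓ W, inf_le_left.trans hV, ⟨hxV, hxW⟩,
      X.presheaf.map (homOfLE inf_le_left).op a + X.presheaf.map (homOfLE inf_le_right).op b,
      fun y hy => ?_⟩
    rw [map_add, TopCat.Presheaf.germ_res_apply, TopCat.Presheaf.germ_res_apply]
    exact congrArg₂ (· + ·) (ha y hy.1) (hb y hy.2)
  neg_mem' := fun {s} hs x => by
    obtain ⟨V, hV, hxV, a, ha⟩ := hs x
    refine ⟨V, hV, hxV, -a, fun y hy => ?_⟩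
    rw [map_neg]
    exact congrArg Neg.neg (ha y hy)

/-- Restriction of sections of `B_X`. -/
def bRestrict (X : Scheme.{u}) {U V : X.Opens} (h : V ≤ U) : bSections X U →+ bSections X V where
  toFun s := ⟨fun x => s.1 ⟨x.1, h x.2⟩, fun x => by
    obtain ⟨W, hW, hxW, a, ha⟩ := s.2 ⟨x.1, h x.2⟩
    refine ⟨W ⊓ V, inf_le_right, ⟨hxW, x.2⟩, X.presheaf.map (homOfLE inf_le_left).op a,
      fun y hy => ?_⟩
    rw [TopCat.Presheaf.germ_res_apply]
    exact ha y hy.1⟩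
  map_zero' := rfl
  map_add' _ _ := rfl

/-- The sheaf `B_X = 𝒪_X / 𝒪_X²` of abelian groups. -/
def BX (X : Scheme.{u}) : TopCat.Presheaf AddCommGrpCat.{u} X.toTopCat where
  obj U := AddCommGrpCat.of (bSections X U.unop)
  map i := AddCommGrpCat.ofHom (bRestrict X i.unop.le)
  map_id _ := rfl
  map_comp _ _ := rfl

/-- A section `s` of `B_X` over `U` and an element `a` of `k(X) / k(X)²` correspond to each other:
all germs of `s` are mapped to `a` by `𝒪_{X,x} / 𝒪_{X,x}² → k(X) / k(X)²`. -/
def HasGenericValue (X : Scheme.{u}) [IsIntegral X] {U : X.Opens} (s : (BX X).obj (op U))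
    (a : ModSq X.functionField) : Prop :=
  ∀ x : U, ModSq.map (algebraMap (X.presheaf.stalk x.1) X.functionField)
    ((show bSections X U from s).1 x) = a

/-! ### The invariant `a(f, g)` -/

open Classical in
/-- `a(f, g)`: if `f = c₀⁴ + c₁⁴ g + c₂⁴ g² + c₃⁴ g³`, the class modulo `K²` of
`(c₁² c₃² + c₂⁴) g / (c₃⁴ g² + c₁⁴)`. When `K` is the function field of a curve over an
algebraically closed field of characteristic two and `f, g ∉ K²`, such `cᵢ` exist and are unique
(the value `0` in the remaining case is a convention). -/
def aInv {K : Type u} [Field K] (f g : K) : ModSq K :=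
  if h : ∃ c : Fin 4 → K, f = c 0 ^ 4 + c 1 ^ 4 * g + c 2 ^ 4 * g ^ 2 + c 3 ^ 4 * g ^ 3 then
    ModSq.mk ((h.choose 1 ^ 2 * h.choose 3 ^ 2 + h.choose 2 ^ 4) * g /
      (h.choose 3 ^ 4 * g ^ 2 + h.choose 1 ^ 4))
  else 0

/-! ### Pseudo-tame rational functions -/

section

variable {k : Type u} [Field k] {X : Scheme.{u}} (p : X ⟶ Spec (.of k))

/-- The structure map `k → 𝒪_{X,x}` of a scheme over `k`. -/
def constToStalk (x : X) : k →+* X.presheaf.stalk x :=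
  ((Scheme.ΓSpecIso (.of k)).inv ≫ p.appTop ≫ X.presheaf.germ ⊤ x trivial).hom

variable [IsIntegral X]

/-- For a rational function `f`, regarded as a morphism from the curve `X` to the projective line
with coordinate `T`, and a closed point `x`: the element `τ` of `𝒪_{X,x}` is the pull-back under
`f` of the standard uniformizer at `f(x)`, which is `T - c` if `f(x) = c ∈ k`, and `1 / T` if
`f(x) = ∞`. -/
def IsPullbackOfUniformizer (f : X.functionField) (x : X) (τ : X.presheaf.stalk x) : Prop :=
  (∃ c : k, algebraMap (X.presheaf.stalk x) X.functionField (τ + constToStalk p x c) = f ∧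
    τ ∈ IsLocalRing.maximalIdeal (X.presheaf.stalk x)) ∨
  ((¬ ∃ r, algebraMap (X.presheaf.stalk x) X.functionField r = f) ∧
    algebraMap (X.presheaf.stalk x) X.functionField τ = f⁻¹)

/-- `f` is pseudo-tame at `x`: for the pull-back `τ` of a uniformizer at `f(x)`, there is
`h ∈ 𝒪_{X,x}` such that `v_x(τ + h⁴)` is an odd number. -/
def IsPseudoTameAt (f : X.functionField) (x : X) : Prop :=
  ∃ τ, IsPullbackOfUniformizer p f x τ ∧
    ∃ (h : X.presheaf.stalk x) (n : ℕ), Odd n ∧ Ring.ord (X.presheaf.stalk x) (τ + h ^ 4) = n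

/-- `f` is pseudo-tame on `U`: it is pseudo-tame at all closed points of `U`. -/
def IsPseudoTameOn (f : X.functionField) (U : X.Opens) : Prop :=
  ∀ x ∈ U, IsClosed {x} → IsPseudoTameAt p f x

/-! ### The obstruction class -/

/-- An open covering of `X` by nonempty open subsets `U i`, together with rational functions `f i`
such that `f i` is pseudo-tame on `U i`. -/
structure LocalData where
  /-- the covering -/
  cover : Covering X.toTopCat
  nonempty : ∀ i, ∃ x, x ∈ cover.U i
  /-- the rational functions -/
  f : cover.I → X.functionField
  isPseudoTameOn : ∀ i, IsPseudoTameOn p (f i) (cover.U i)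

variable {p} in
/-- `b` is the class in `H¹(X, B_X)` of the Čech cocycle `(a(f i, f j))` on the covering `(U i)`. -/
def LocalData.IsClass (D : LocalData p) (b : H1 (BX X)) : Prop :=
  ∃ s : cocycles (BX X) D.cover,
    (∀ i j, HasGenericValue X (s.1 i j) (aInv (D.f i) (D.f j))) ∧ b = H1.mk (BX X) D.cover s

open Classical in
/-- The obstruction class `β(X) ∈ H¹(X, B_X)`: the class of the cocycle `(a(f i, f j))` for some
choice of a covering with pseudo-tame functions (the value `0` in the absence of such a class is a
convention). -/
def beta : H1 (BX X) :=
  if h : ∃ (b : H1 (BX X)) (D : LocalData p), D.IsClass b then h.choose else 0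

end

end

end PseudoTame

/-!
Let `K = k(X)`, so that `K = K² ⊕ K² g` for every `g` that is not a square. Two facts about
`a(f, g)` carry the proof.

* It is a cocycle: `a(f, g) + a(g, h) = a(f, h)` modulo `K²` (`aInv_add_aInv`). This is an identity
  between rational functions of the coordinates of `f` and `g`, whose two sides differ by an
  explicit square.
* Over a discrete valuation ring with uniformizer `t`, the function `f` is pseudo-tame if and only
  if `a(f, t)` is regular modulo squares (`exists_uniformizer_pullback_iff`). If
  `f = u² + v² t` and `u = u₀² + u₁² t`, both conditions say that `v² t` dominates `u₁⁴ t²`.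

Hence the functions that are pseudo-tame at a closed point are one class for the relation that
`a(f, g)` is regular there (`IsPseudoTameAt.iff_isRegularModSqAt_aInv`). As the curve is normal, a
class in `K / K²` that is regular at all closed points of `U` is the same as a section of `B_X` over
`U`, so a local datum has a cocycle and a class. The class is that of any refinement, and two local
data are both parts of their disjoint union, so they have the same class. A pseudo-tame function on
`X` is a local datum with one member and cocycle `a(f, f) = 0`. Conversely, if the cocycle
`a(fᵢ, fⱼ)` becomes the coboundary of `aᵢ ∈ K / K²`, then a function `g` with `a(f₀, g) = a₀` has
`a(fᵢ, g) = aᵢ` for all `i`, and is pseudo-tame everywhere.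

It remains to see that `a(f, ·)` is surjective. Let `D x` be the coefficient `b` in `x = a² + b² f`;
the operator `D` is half-linear, that is, `D (c² x) = c (D x)`. For functions `g` of the form
`r⁴ f + c⁴ f² + f³`, the equation `a(f, g) = a` reduces to an equation `D r + m r = w`
(`exists_aInv_eq`). Smoothness provides a function `T` whose differential generates the
differentials of an affine chart, so that `K` is finite and separable over `k(T)`
(`finite_and_isSeparable_functionField`). The half-linear operator attached to `T` halves degrees of
polynomials in `T`, so that, composed with a multiplication, it preserves a finite-dimensional
`k`-space containing any given element (`exists_halfDeriv_mul_stable`). On such a space `1 + φ` is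
surjective for every half-linear `φ`, because `k` is algebraically closed
(`exists_add_halfLinear_eq`). The same functions `T` provide uniformizers `T - c` at the closed
points, and so the existence of local data.
-/

namespace PseudoTame

/-! ### The invariant `a(f, g)` over a field with a one-element `2`-basis -/

section FieldAlgebra

/-- `g` is a `2`-basis of the field `K` of characteristic two: `K = K² ⊕ K² g`. -/
def IsTwoBasis {K : Type u} [Field K] (g : K) : Prop :=
  ¬ IsSquare g ∧ ∀ x : K, ∃ a b : K, x = a ^ 2 + b ^ 2 * g

theorem ModSq.mk_eq_mk_iff {R : Type u} [CommRing R] [CharP R 2] {a b : R} :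
    ModSq.mk a = ModSq.mk b ↔ ∃ c : R, a = b + c ^ 2 := by
  have key : ∀ x : R, x ∈ AddSubgroup.closure (Set.range fun a : R => a ^ 2) ↔
      ∃ c, x = c ^ 2 := by
    intro x
    constructor
    · intro hx
      induction hx using AddSubgroup.closure_induction with
      | mem x hx => obtain ⟨c, rfl⟩ := hx; exact ⟨c, rfl⟩
      | zero => exact ⟨0, by simp⟩
      | add x y _ _ hx hy =>
        obtain ⟨c, rfl⟩ := hx
        obtain ⟨d, rfl⟩ := hy
        exact ⟨c + d, (CharTwo.add_sq c d).symm⟩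
      | neg x _ hx => obtain ⟨c, rfl⟩ := hx; exact ⟨c, CharTwo.neg_eq _⟩
    · rintro ⟨c, rfl⟩
      exact AddSubgroup.subset_closure ⟨c, rfl⟩
  refine (QuotientAddGroup.eq.trans (key _)).trans ⟨?_, ?_⟩
  · rintro ⟨c, hc⟩
    refine ⟨c, ?_⟩
    rw [← hc, CharTwo.neg_eq, add_comm a b, ← add_assoc, CharTwo.add_self_eq_zero, zero_add]
  · rintro ⟨c, rfl⟩
    refine ⟨c, ?_⟩
    rw [CharTwo.neg_eq, add_comm b, add_assoc, CharTwo.add_self_eq_zero, add_zero]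

theorem ModSq.mk_surjective {R : Type u} [CommRing R] :
    Function.Surjective (ModSq.mk : R → ModSq R) :=
  QuotientAddGroup.mk_surjective

theorem ModSq.mk_add {R : Type u} [CommRing R] (a b : R) :
    ModSq.mk (a + b) = ModSq.mk a + ModSq.mk b := rfl

@[simp]
theorem ModSq.mk_zero {R : Type u} [CommRing R] : ModSq.mk (0 : R) = 0 := rfl

theorem ModSq.map_mk {R S : Type u} [CommRing R] [CommRing S] (φ : R →+* S) (a : R) :
    ModSq.map φ (ModSq.mk a) = ModSq.mk (φ a) := rfl

theorem ModSq.add_self {R : Type u} [CommRing R] [CharP R 2] (a : ModSq R) : a + a = 0 := by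
  obtain ⟨a, rfl⟩ := ModSq.mk_surjective a
  rw [← ModSq.mk_add, CharTwo.add_self_eq_zero, ModSq.mk_zero]

theorem ModSq.neg_eq {R : Type u} [CommRing R] [CharP R 2] (a : ModSq R) : -a = a :=
  neg_eq_of_add_eq_zero_left (ModSq.add_self a)

variable {K : Type u} [Field K] [CharP K 2]

namespace IsTwoBasis

theorem coord_unique {g : K} (hg : ¬ IsSquare g) {a b a' b' : K}
    (h : a ^ 2 + b ^ 2 * g = a' ^ 2 + b' ^ 2 * g) : a = a' ∧ b = b' := by
  have h' : (a + a') ^ 2 = (b + b') ^ 2 * g := by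
    have h2 : (2 : K) = 0 := CharTwo.two_eq_zero
    linear_combination h + (a * a' + a' ^ 2 - b * b' * g - b ^ 2 * g) * h2
  have hb : b + b' = 0 := by
    by_contra hb
    refine hg ⟨(a + a') / (b + b'), ?_⟩
    field_simp
    linear_combination -h'
  have ha : a + a' = 0 := by
    rw [hb] at h'
    simpa using h'
  exact ⟨CharTwo.add_eq_zero.1 ha, CharTwo.add_eq_zero.1 hb⟩

theorem of_not_isSquare {g f : K} (hg : IsTwoBasis g) (hf : ¬ IsSquare f) : IsTwoBasis f := by
  refine ⟨hf, fun x => ?_⟩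
  obtain ⟨p, q, rfl⟩ := hg.2 f
  have hq : q ≠ 0 := by
    rintro rfl
    exact hf ⟨p, by ring⟩
  obtain ⟨a, b, rfl⟩ := hg.2 x
  refine ⟨a + b * p / q, b / q, ?_⟩
  have h2 : (2 : K) = 0 := CharTwo.two_eq_zero
  field_simp
  linear_combination (-(a * b * p * q) - b ^ 2 * p ^ 2) * h2

omit [CharP K 2] in
theorem exists_coord {g : K} (hg : IsTwoBasis g) (f : K) : ∃ u₀ u₁ v₀ v₁ : K,
    f = (u₀ ^ 2 + u₁ ^ 2 * g) ^ 2 + (v₀ ^ 2 + v₁ ^ 2 * g) ^ 2 * g := by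
  obtain ⟨u, v, rfl⟩ := hg.2 f
  obtain ⟨u₀, u₁, rfl⟩ := hg.2 u
  obtain ⟨v₀, v₁, rfl⟩ := hg.2 v
  exact ⟨u₀, u₁, v₀, v₁, rfl⟩

theorem sq_add_sq_mul_ne_zero {g : K} (hg : ¬ IsSquare g) {a b : K} (h : a ≠ 0 ∨ b ≠ 0) :
    a ^ 2 + b ^ 2 * g ≠ 0 := by
  intro h0
  have := coord_unique hg (a := a) (b := b) (a' := 0) (b' := 0) (by simpa using h0)
  tauto

end IsTwoBasis

/-- The value of `a(f, g)` in terms of the coordinates of `f` with respect to `g`. -/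
theorem aInv_eq {g : K} (hg : ¬ IsSquare g) {f u₀ u₁ v₀ v₁ : K}
    (hf : f = (u₀ ^ 2 + u₁ ^ 2 * g) ^ 2 + (v₀ ^ 2 + v₁ ^ 2 * g) ^ 2 * g) :
    aInv f g = ModSq.mk ((v₀ ^ 2 * v₁ ^ 2 + u₁ ^ 4) * g / (v₀ ^ 2 + v₁ ^ 2 * g) ^ 2) := by
  have h2 : (2 : K) = 0 := CharTwo.two_eq_zero
  have h : ∃ c : Fin 4 → K, f = c 0 ^ 4 + c 1 ^ 4 * g + c 2 ^ 4 * g ^ 2 + c 3 ^ 4 * g ^ 3 := by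
    refine ⟨![u₀, v₀, u₁, v₁], ?_⟩
    rw [hf]
    simp
    linear_combination (u₀ ^ 2 * u₁ ^ 2 * g + v₀ ^ 2 * v₁ ^ 2 * g ^ 2) * h2
  rw [aInv, dif_pos h]
  have hc := h.choose_spec
  set c := h.choose
  obtain ⟨hu, hv⟩ := IsTwoBasis.coord_unique hg (a := c 0 ^ 2 + c 2 ^ 2 * g)
    (b := c 1 ^ 2 + c 3 ^ 2 * g) (a' := u₀ ^ 2 + u₁ ^ 2 * g) (b' := v₀ ^ 2 + v₁ ^ 2 * g) (by
      rw [← hf, hc]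
      linear_combination (c 0 ^ 2 * c 2 ^ 2 * g + c 1 ^ 2 * c 3 ^ 2 * g ^ 2) * h2)
  obtain ⟨-, h2'⟩ := IsTwoBasis.coord_unique hg hu
  obtain ⟨h1', h3'⟩ := IsTwoBasis.coord_unique hg hv
  rw [h1', h2', h3']
  congr 2
  linear_combination (- v₀ ^ 2 * v₁ ^ 2 * g) * h2

/-- The cocycle relation. For `f = u² + v² g` and `g = p² + q² h`, where `u = u₀² + u₁² g` and
`v = v₀² + v₁² g`, the two sides differ by the square of `p (u₁² + v₀ v₁) / v`. -/
theorem aInv_add_aInv {f g h : K} (hf : ¬ IsSquare f) (hg : ¬ IsSquare g) (hh : IsTwoBasis h) :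
    aInv f g + aInv g h = aInv f h := by
  have h2 : (2 : K) = 0 := CharTwo.two_eq_zero
  obtain ⟨p₀, p₁, q₀, q₁, hgh⟩ := hh.exists_coord g
  obtain ⟨u₀, u₁, v₀, v₁, hfg⟩ := (hh.of_not_isSquare hg).exists_coord f
  obtain ⟨p, hp⟩ : ∃ p, p = p₀ ^ 2 + p₁ ^ 2 * h := ⟨_, rfl⟩
  obtain ⟨q, hq⟩ : ∃ q, q = q₀ ^ 2 + q₁ ^ 2 * h := ⟨_, rfl⟩
  obtain ⟨v, hv⟩ : ∃ v, v = v₀ ^ 2 + v₁ ^ 2 * g := ⟨_, rfl⟩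
  have hg' : g = p ^ 2 + q ^ 2 * h := by rw [hp, hq]; exact hgh
  have hq0 : q ≠ 0 := by
    rintro rfl
    exact hg ⟨p, by rw [hg']; ring⟩
  have hv0 : v ≠ 0 := by
    rintro rfl
    rw [← hv] at hfg
    exact hf ⟨u₀ ^ 2 + u₁ ^ 2 * g, by rw [hfg]; ring⟩
  set U₁ := u₁ * q + (v₀ + v₁ * p) * p₁ + v₁ * q * p₀ with hU₁
  set V₀ := (v₀ + v₁ * p) * q₀ + v₁ * q * q₁ * h with hV₀
  set V₁ := (v₀ + v₁ * p) * q₁ + v₁ * q * q₀ with hV₁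
  set U₀ := u₀ + u₁ * p + (v₀ + v₁ * p) * p₀ + v₁ * q * p₁ * h with hU₀
  have hV : V₀ ^ 2 + V₁ ^ 2 * h = v * q := by
    grind
  have hU : U₀ ^ 2 + U₁ ^ 2 * h = u₀ ^ 2 + u₁ ^ 2 * g + v * p := by
    grind
  have hfh : f = (U₀ ^ 2 + U₁ ^ 2 * h) ^ 2 + (V₀ ^ 2 + V₁ ^ 2 * h) ^ 2 * h := by
    rw [hU, hV, hfg, ← hv]
    grind
  rw [aInv_eq hg hfg, aInv_eq hh.1 hgh, aInv_eq hh.1 hfh, hV, ← hq, ← hv, ← ModSq.mk_add,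
    ModSq.mk_eq_mk_iff]
  refine ⟨p * (u₁ ^ 2 + v₀ * v₁) / v, ?_⟩
  field_simp
  clear_value U₀
  clear hU hfh hU₀ hfg hgh
  grind

theorem aInv_self {f : K} (hf : ¬ IsSquare f) : aInv f f = 0 := by
  rw [aInv_eq hf (u₀ := 0) (u₁ := 0) (v₀ := 1) (v₁ := 0) (by ring)]
  simp

theorem aInv_inv_self {f : K} (hf : ¬ IsSquare f) : aInv f⁻¹ f = 0 := by
  have h0 : f ≠ 0 := by
    rintro rfl
    exact hf ⟨0, by simp⟩
  rw [aInv_eq hf (u₀ := 0) (u₁ := 0) (v₀ := 0) (v₁ := f⁻¹) (by field_simp; ring)]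
  simp

theorem aInv_comm {f g : K} (hf : IsTwoBasis f) (hg : ¬ IsSquare g) : aInv f g = aInv g f := by
  have h := aInv_add_aInv hf.1 hg hf
  rw [aInv_self hf.1] at h
  rw [← ModSq.neg_eq (aInv g f)]
  exact eq_neg_of_add_eq_zero_left h

theorem aInv_inv_left {f g : K} (hf : ¬ IsSquare f) (hg : IsTwoBasis g) :
    aInv f⁻¹ g = aInv f g := by
  have hf' : ¬ IsSquare f⁻¹ := fun h => hf (by simpa using h.inv)
  rw [← aInv_add_aInv hf' hf hg, aInv_inv_self hf, zero_add]

end FieldAlgebra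

/-! ### Pseudo-tameness over a discrete valuation ring -/

section Valuation

open scoped WithZero

variable {K : Type u} [Field K] (v : Valuation K ℤᵐ⁰)

/-- `x` is nonzero and has odd valuation. -/
def HasOddValuation (x : K) : Prop :=
  x ≠ 0 ∧ Odd (WithZero.log (v x))

variable {v} {t : K} (ht : v t = WithZero.exp (-1))

include ht in
/-- A square and `t` times a square never have the same valuation. -/
theorem valuation_sq_ne {x y : K} (hy : y ≠ 0) : v (x ^ 2) ≠ v (y ^ 2 * t) := by
  intro h
  have hy' : v y ≠ 0 := by simpa using hy
  have hx' : v x ≠ 0 := by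
    intro hx
    simp [hx, ht, hy] at h
  have h' := congrArg WithZero.log h
  rw [map_mul, map_pow, map_pow, ht, WithZero.log_mul (pow_ne_zero 2 hy') WithZero.exp_ne_zero,
    WithZero.log_pow, WithZero.log_pow, WithZero.log_exp] at h'
  simp only [nsmul_eq_mul] at h'
  push_cast at h'
  omega

include ht in
theorem valuation_sq_add_sq_mul (x y : K) :
    v (x ^ 2 + y ^ 2 * t) = max (v (x ^ 2)) (v (y ^ 2 * t)) := by
  by_cases hy : y = 0
  · simp [hy]
  · exact v.map_add_of_distinct_val (valuation_sq_ne ht hy)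

include ht in
theorem hasOddValuation_sq_mul {y : K} (hy : y ≠ 0) {x : K} (hx : v x = v (y ^ 2 * t)) :
    HasOddValuation v x := by
  have hy' : v y ≠ 0 := by simpa using hy
  refine ⟨?_, ?_⟩
  · rintro rfl
    simp [ht, hy] at hx
  · rw [hx, map_mul, map_pow, ht, WithZero.log_mul (pow_ne_zero 2 hy') WithZero.exp_ne_zero,
      WithZero.log_pow, WithZero.log_exp]
    simp only [nsmul_eq_mul]
    push_cast
    exact ⟨WithZero.log (v y) - 1, by ring⟩

theorem not_hasOddValuation_of_eq_sq {x y : K} (h : v x = v (y ^ 2)) :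
    ¬ HasOddValuation v x := by
  rintro ⟨-, ho⟩
  rw [h, map_pow, WithZero.log_pow] at ho
  simp only [nsmul_eq_mul] at ho
  push_cast at ho
  obtain ⟨m, hm⟩ := ho
  omega

variable [CharP K 2]

include ht in
/-- For `g = u² + w² t`, with `u = u₀² + u₁² t` and `w = v₀² + v₁² t`: some `g + h⁴` has odd
valuation if and only if `w² t` dominates `u₁⁴ t²`, which is the condition for `a(g, t)` to be
regular modulo squares. -/
theorem exists_hasOddValuation_iff {g u₀ u₁ v₀ v₁ : K} (hw : v₀ ≠ 0 ∨ v₁ ≠ 0)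
    (hg : g = (u₀ ^ 2 + u₁ ^ 2 * t) ^ 2 + (v₀ ^ 2 + v₁ ^ 2 * t) ^ 2 * t) :
    (∃ h : K, HasOddValuation v (g + h ^ 4)) ↔
      ∃ o s : K, v o ≤ 1 ∧
        (v₀ ^ 2 * v₁ ^ 2 + u₁ ^ 4) * t / (v₀ ^ 2 + v₁ ^ 2 * t) ^ 2 = o + s ^ 2 := by
  have h2 : (2 : K) = 0 := CharTwo.two_eq_zero
  have ht0 : t ≠ 0 := by
    rintro rfl
    rw [map_zero] at ht
    exact WithZero.exp_ne_zero ht.symm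
  have hvt : 0 < v t := by simpa [zero_lt_iff] using ht0
  have hmax := valuation_sq_add_sq_mul ht v₀ v₁
  obtain ⟨w, hwdef⟩ : ∃ w, w = v₀ ^ 2 + v₁ ^ 2 * t := ⟨_, rfl⟩
  rw [← hwdef] at hg hmax ⊢
  have hw0 : w ≠ 0 := by
    intro h0
    rw [h0, map_zero] at hmax
    have h1 : v (v₀ ^ 2) ≤ 0 := hmax ▸ le_max_left _ _
    have h2 : v (v₁ ^ 2 * t) ≤ 0 := hmax ▸ le_max_right _ _
    simp only [map_pow, map_mul, nonpos_iff_eq_zero, mul_eq_zero, hvt.ne', or_false,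
      pow_eq_zero_iff two_ne_zero, map_eq_zero] at h1 h2
    tauto
  have hvw : 0 < v w := by simpa [zero_lt_iff] using hw0
  -- The term of `a(g, t)` involving `v₀ v₁` is always regular.
  have hreg : v (v₀ ^ 2 * v₁ ^ 2 * t / w ^ 2) ≤ 1 := by
    rw [map_div₀, div_le_one₀ (by simpa using pow_pos hvw 2), mul_assoc, map_mul, map_pow v w,
      sq (v w)]
    exact mul_le_mul' (hmax ▸ le_max_left _ _) (hmax ▸ le_max_right _ _)
  -- The other term is `t` times a square, so it is regular modulo squares only if it is regular.
  have hterm : (v₀ ^ 2 * v₁ ^ 2 + u₁ ^ 4) * t / w ^ 2 =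
      v₀ ^ 2 * v₁ ^ 2 * t / w ^ 2 + (u₁ ^ 2 / w) ^ 2 * t := by
    field_simp
  constructor
  · rintro ⟨h, hh⟩
    refine ⟨_, 0, ?_, by rw [zero_pow two_ne_zero, add_zero]⟩
    rw [hterm]
    refine v.map_add_le hreg ?_
    have hgh : g + h ^ 4 = ((u₀ + h) ^ 2 + u₁ ^ 2 * t) ^ 2 + w ^ 2 * t := by
      rw [hg]
      grind
    have hlt : v (((u₀ + h) ^ 2 + u₁ ^ 2 * t) ^ 2) < v (w ^ 2 * t) := by
      by_contra hle
      refine not_hasOddValuation_of_eq_sq (y := (u₀ + h) ^ 2 + u₁ ^ 2 * t) ?_ hh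
      rw [hgh, valuation_sq_add_sq_mul ht, max_eq_left (not_lt.1 hle)]
    have hle : v (u₁ ^ 2 * t) ≤ v ((u₀ + h) ^ 2 + u₁ ^ 2 * t) := by
      rw [valuation_sq_add_sq_mul ht]
      exact le_max_right _ _
    have hlt' : v (u₁ ^ 4 * t) * v t < v (w ^ 2) * v t := by
      rw [← map_mul, ← map_mul]
      refine lt_of_le_of_lt ?_ hlt
      rw [show u₁ ^ 4 * t * t = (u₁ ^ 2 * t) ^ 2 by ring, map_pow, map_pow]
      exact pow_le_pow_left' hle 2
    rw [show (u₁ ^ 2 / w) ^ 2 * t = u₁ ^ 4 * t / w ^ 2 by field_simp, map_div₀]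
    exact (div_le_one₀ (by simpa using pow_pos hvw 2)).2 (lt_of_mul_lt_mul_right' hlt').le
  · rintro ⟨o, s, ho, hos⟩
    have hle : v ((u₁ ^ 2 / w) ^ 2 * t) ≤ 1 := by
      rw [hterm] at hos
      have ho' : s ^ 2 + (u₁ ^ 2 / w) ^ 2 * t = o + v₀ ^ 2 * v₁ ^ 2 * t / w ^ 2 := by
        linear_combination hos + (s ^ 2 - v₀ ^ 2 * v₁ ^ 2 * t / w ^ 2) * h2
      calc v ((u₁ ^ 2 / w) ^ 2 * t) ≤ v (s ^ 2 + (u₁ ^ 2 / w) ^ 2 * t) := by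
            rw [valuation_sq_add_sq_mul ht]
            exact le_max_right _ _
        _ ≤ 1 := ho' ▸ v.map_add_le ho hreg
    have hlt : v ((u₁ ^ 2 / w) ^ 2 * t) < 1 := by
      by_cases hu : u₁ = 0
      · simp [hu]
      · refine lt_of_le_of_ne hle fun h => ?_
        exact valuation_sq_ne ht (x := 1) (y := u₁ ^ 2 / w) (by positivity) (by simpa using h.symm)
    refine ⟨u₀, hasOddValuation_sq_mul ht hw0 ?_⟩
    have hgh : g + u₀ ^ 4 = (u₁ ^ 2 * t) ^ 2 + w ^ 2 * t := by
      rw [hg]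
      grind
    rw [hgh, valuation_sq_add_sq_mul ht, max_eq_right]
    rw [show (u₁ ^ 2 * t) ^ 2 = (u₁ ^ 2 / w) ^ 2 * t * (w ^ 2 * t) by field_simp,
      map_mul v _ (w ^ 2 * t)]
    exact mul_le_of_le_one_left' hlt.le

include ht in
theorem exists_hasOddValuation_iff_aInv (htb : IsTwoBasis t) {g : K} (hg : ¬ IsSquare g) :
    (∃ h : K, HasOddValuation v (g + h ^ 4)) ↔
      ∃ o : K, v o ≤ 1 ∧ ModSq.mk o = aInv g t := by
  obtain ⟨u₀, u₁, v₀, v₁, h⟩ := htb.exists_coord g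
  have hv : v₀ ≠ 0 ∨ v₁ ≠ 0 := by
    by_contra! h0
    refine hg ⟨u₀ ^ 2 + u₁ ^ 2 * t, ?_⟩
    rw [h, h0.1, h0.2]
    ring
  rw [exists_hasOddValuation_iff ht hv h, aInv_eq htb.1 h]
  refine exists_congr fun o => ?_
  rw [exists_and_left, eq_comm (a := ModSq.mk o), ModSq.mk_eq_mk_iff]

end Valuation

section DVR

open scoped WithZero

variable {R K : Type u} [CommRing R] [IsDomain R] [IsDiscreteValuationRing R] [Field K]
  [Algebra R K] [IsFractionRing R K]

theorem valuation_irreducible {t : R} (ht : Irreducible t) :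
    (IsDiscreteValuationRing.maximalIdeal R).valuation K (algebraMap R K t) =
      WithZero.exp (-1) := by
  rw [IsDedekindDomain.HeightOneSpectrum.valuation_of_algebraMap]
  exact IsDedekindDomain.HeightOneSpectrum.intValuation_singleton _ ht.ne_zero ht.maximalIdeal_eq

theorem exists_ord_eq_odd_iff (z : R) :
    (∃ n : ℕ, Odd n ∧ Ring.ord R z = n) ↔
      HasOddValuation ((IsDiscreteValuationRing.maximalIdeal R).valuation K)
        (algebraMap R K z) := by
  obtain ⟨t, ht⟩ := IsDiscreteValuationRing.exists_irreducible R
  by_cases hz : z = 0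
  · simp [hz, HasOddValuation]
  obtain ⟨n, w, rfl⟩ := IsDiscreteValuationRing.eq_unit_mul_pow_irreducible hz ht
  have hv : (IsDiscreteValuationRing.maximalIdeal R).valuation K (algebraMap R K (w * t ^ n)) =
      WithZero.exp (-1) ^ n := by
    have hw : (IsDiscreteValuationRing.maximalIdeal R).valuation K (algebraMap R K w) = 1 := by
      rw [IsDedekindDomain.HeightOneSpectrum.valuation_eq_one_iff_notMem]
      exact fun h => (IsLocalRing.mem_maximalIdeal _).1 h w.isUnit
    rw [map_mul, map_mul, map_pow, map_pow, hw, one_mul, valuation_irreducible ht]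
  rw [HasOddValuation, hv, WithZero.log_pow, WithZero.log_exp, Ring.ord_eq_addVal,
    IsDiscreteValuationRing.addVal_def' w ht n]
  simp only [ne_eq, FaithfulSMul.algebraMap_eq_zero_iff, hz, not_false_eq_true, true_and]
  constructor
  · rintro ⟨m, hm, h⟩
    rw [ENat.natCast_inj.1 h]
    simpa using hm
  · intro h
    exact ⟨n, by simpa using h, rfl⟩

variable [CharP K 2]

/-- For a function `f` with a value `c` at the closed point and for a function `f` with a pole
there, the condition of pseudo-tameness takes the form that `a(f, t)` is regular modulo squares,
where `t` is any uniformizer. -/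
theorem exists_uniformizer_pullback_iff {k : Type u} [Field k] [IsAlgClosed k] (κ : k →+* R)
    (hκ : ∀ r : R, ∃ c : k, r - κ c ∈ IsLocalRing.maximalIdeal R) {t : R} (ht : Irreducible t)
    (htb : IsTwoBasis (algebraMap R K t)) (f : K) :
    (∃ τ : R, ((∃ c : k, algebraMap R K (τ + κ c) = f ∧ τ ∈ IsLocalRing.maximalIdeal R) ∨
        ((¬ ∃ r, algebraMap R K r = f) ∧ algebraMap R K τ = f⁻¹)) ∧
      ∃ (h : R) (n : ℕ), Odd n ∧ Ring.ord R (τ + h ^ 4) = n) ↔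
    ¬ IsSquare f ∧ ∃ r : R, ModSq.mk (algebraMap R K r) = aInv f (algebraMap R K t) := by
  have h2 : (2 : K) = 0 := CharTwo.two_eq_zero
  have hvt := valuation_irreducible (K := K) ht
  set v := (IsDiscreteValuationRing.maximalIdeal R).valuation K with hv
  have hint (x : K) : v x ≤ 1 ↔ ∃ r : R, algebraMap R K r = x := by
    refine ⟨IsDiscreteValuationRing.exists_lift_of_le_one, ?_⟩
    rintro ⟨r, rfl⟩
    exact IsDedekindDomain.HeightOneSpectrum.valuation_le_one _ r
  have hint' (b : ModSq K) : (∃ o : K, v o ≤ 1 ∧ ModSq.mk o = b) ↔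
      ∃ r : R, ModSq.mk (algebraMap R K r) = b := by
    constructor
    · rintro ⟨o, ho, rfl⟩
      obtain ⟨r, rfl⟩ := (hint o).1 ho
      exact ⟨r, rfl⟩
    · rintro ⟨r, rfl⟩
      exact ⟨_, (hint _).2 ⟨r, rfl⟩, rfl⟩
  have hsq {x : K} (hx : IsSquare x) (h : K) : ¬ HasOddValuation v (x + h ^ 4) := by
    obtain ⟨y, rfl⟩ := hx
    refine not_hasOddValuation_of_eq_sq (y := y + h ^ 2) ?_
    rw [CharTwo.add_sq]
    ring_nf
  -- For integral `x`, an `h` for which `x + h⁴` has odd valuation is itself integral.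
  have hlift (τ : R) : (∃ (h : R) (n : ℕ), Odd n ∧ Ring.ord R (τ + h ^ 4) = n) ↔
      ∃ h : K, HasOddValuation v (algebraMap R K τ + h ^ 4) := by
    simp only [exists_ord_eq_odd_iff (K := K), ← hv]
    constructor
    · rintro ⟨h, hh⟩
      exact ⟨algebraMap R K h, by simpa using hh⟩
    · rintro ⟨h, hh⟩
      by_cases hle : v h ≤ 1
      · obtain ⟨r, rfl⟩ := (hint h).1 hle
        exact ⟨r, by simpa using hh⟩
      · refine absurd hh (not_hasOddValuation_of_eq_sq (y := h ^ 2) ?_)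
        rw [← pow_mul]
        refine v.map_add_eq_of_lt_right (lt_of_le_of_lt ((hint _).2 ⟨τ, rfl⟩) ?_)
        rw [map_pow]
        exact one_lt_pow₀ (not_le.1 hle) (by norm_num)
  by_cases hf : ∃ r, algebraMap R K r = f
  · obtain ⟨r, rfl⟩ := hf
    have hshift (c : k) (x : K) : (∃ h, HasOddValuation v (x + algebraMap R K (κ c) + h ^ 4)) ↔
        ∃ h, HasOddValuation v (x + h ^ 4) := by
      obtain ⟨d, rfl⟩ := IsAlgClosed.exists_pow_nat_eq c (n := 4) (by norm_num)
      constructor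
      · rintro ⟨h, hh⟩
        refine ⟨h + algebraMap R K (κ d), ?_⟩
        convert hh using 1
        simp only [map_pow]
        grind
      · rintro ⟨h, hh⟩
        refine ⟨h + algebraMap R K (κ d), ?_⟩
        convert hh using 1
        simp only [map_pow]
        grind
    trans ∃ h, HasOddValuation v (algebraMap R K r + h ^ 4)
    · constructor
      · rintro ⟨τ, ⟨c, hτ, -⟩ | ⟨hτ, -⟩, hodd⟩
        · rw [← hτ, map_add, hshift]
          exact (hlift τ).1 hodd
        · exact absurd ⟨r, rfl⟩ hτ
      · intro hodd
        obtain ⟨c, hc⟩ := hκ r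
        refine ⟨r - κ c, Or.inl ⟨c, by simp, hc⟩, (hlift _).2 ?_⟩
        rw [← hshift c]
        simpa using hodd
    · rw [← hint']
      constructor
      · intro h
        have hns : ¬ IsSquare (algebraMap R K r) := fun hs => hsq hs _ h.choose_spec
        exact ⟨hns, (exists_hasOddValuation_iff_aInv hvt htb hns).1 h⟩
      · rintro ⟨hns, h⟩
        exact (exists_hasOddValuation_iff_aInv hvt htb hns).2 h
  · obtain ⟨τ, hτ⟩ : ∃ τ, algebraMap R K τ = f⁻¹ := by
      rw [← hint, map_inv₀]
      refine inv_le_one_of_one_le₀ (not_lt.1 fun h => hf ((hint f).1 h.le))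
    have hinv {x : K} : IsSquare x⁻¹ ↔ IsSquare x :=
      ⟨fun h => by simpa using h.inv, fun h => h.inv⟩
    trans ∃ h, HasOddValuation v (f⁻¹ + h ^ 4)
    · constructor
      · rintro ⟨τ', ⟨c, hτ', -⟩ | ⟨-, hτ'⟩, hodd⟩
        · exact absurd ⟨_, hτ'⟩ hf
        · rw [← hτ']
          exact (hlift τ').1 hodd
      · intro hodd
        rw [← hτ] at hodd
        exact ⟨τ, Or.inr ⟨hf, hτ⟩, (hlift τ).2 hodd⟩
    · rw [← hint']
      constructor
      · intro h
        have hns : ¬ IsSquare f⁻¹ := fun hs => hsq hs _ h.choose_spec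
        have hns' := mt hinv.2 hns
        refine ⟨hns', ?_⟩
        rw [← aInv_inv_left hns' htb]
        exact (exists_hasOddValuation_iff_aInv hvt htb hns).1 h
      · rintro ⟨hns, h⟩
        rw [← aInv_inv_left hns htb] at h
        exact (exists_hasOddValuation_iff_aInv hvt htb (mt hinv.1 hns)).2 h

end DVR

/-! ### Half-linear operators -/

section HalfLinear

open Polynomial

variable {k : Type*} [Field k] [IsAlgClosed k] [CharP k 2]

/-- Over an algebraically closed field, `1 + φ` is surjective for a half-linear operator `φ` on a
finite-dimensional space: if `φⁿ w = ∑ cᵢ φⁱ w`, a solution of `x + φ x = w` in the span of the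
`φⁱ w` amounts to a root `b` of `b ^ 2ⁿ + ∑ (b cᵢ) ^ 2ⁱ + 1`. -/
theorem exists_add_halfLinear_eq {W : Type*} [AddCommGroup W] [Module k W] [Module.Finite k W]
    (φ : W →+ W) (hφ : ∀ (c : k) (x : W), φ (c ^ 2 • x) = c • φ x) (w : W) :
    ∃ x, x + φ x = w := by
  have two_smul_zero (y : W) : y + y = 0 := by
    rw [← two_smul k, CharTwo.two_eq_zero, zero_smul]
  let s : ℕ →o Submodule k W :=
    ⟨fun n => Submodule.span k (Set.range fun i : Fin n => φ^[i] w), fun m n hmn => by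
      refine Submodule.span_mono ?_
      rintro _ ⟨i, rfl⟩
      exact ⟨Fin.castLE hmn i, rfl⟩⟩
  obtain ⟨n, hn⟩ := monotone_stabilizes_iff_noetherian.2 (inferInstance : IsNoetherian k W) s
  have hmem : φ^[n] w ∈ s n := by
    rw [hn (n + 1) n.le_succ]
    exact Submodule.subset_span ⟨Fin.last n, rfl⟩
  obtain ⟨c, hc⟩ : ∃ c : ℕ → k, ∑ i ∈ Finset.range n, c i • φ^[i] w = φ^[n] w := by
    obtain ⟨c, hc⟩ := (Submodule.mem_span_range_iff_exists_fun k).1 hmem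
    refine ⟨fun i => if h : i < n then c ⟨i, h⟩ else 0, ?_⟩
    rw [← hc, ← Fin.sum_univ_eq_sum_range (fun i => (if h : i < n then c ⟨i, h⟩ else 0) • φ^[i] w)]
    simp
  obtain ⟨b, hb⟩ : ∃ b : k, b ^ 2 ^ n = 1 + ∑ i ∈ Finset.range n, (b * c i) ^ 2 ^ i := by
    let Q : k[X] := C 1 + ∑ i ∈ Finset.range n, C (c i ^ 2 ^ i) * X ^ 2 ^ i
    have hQ : Q.degree < (2 ^ n : ℕ) := by
      rw [← mem_degreeLT]
      refine add_mem (mem_degreeLT.2 ?_) (sum_mem fun i hi => mem_degreeLT.2 ?_)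
      · refine lt_of_le_of_lt degree_C_le ?_
        exact_mod_cast Nat.two_pow_pos n
      · refine lt_of_le_of_lt (degree_C_mul_X_pow_le _ _) ?_
        exact_mod_cast Nat.pow_lt_pow_right one_lt_two (Finset.mem_range.1 hi)
    obtain ⟨b, hb⟩ := IsAlgClosed.exists_root (X ^ 2 ^ n + Q) (by
      rw [degree_add_eq_left_of_degree_lt (by rwa [degree_X_pow]), degree_X_pow]
      exact_mod_cast (Nat.two_pow_pos n).ne')
    refine ⟨b, ?_⟩
    rw [IsRoot, eval_add, CharTwo.add_eq_zero] at hb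
    simpa [Q, eval_finsetSum, mul_pow, mul_comm] using hb
  choose sqrt hsqrt using fun c : k => IsAlgClosed.exists_pow_nat_eq c two_pos
  let e : ℕ → k := fun i => Nat.rec 1 (fun i y => sqrt (y + b * c i)) i
  have he (i : ℕ) : e (i + 1) ^ 2 = e i + b * c i := hsqrt _
  have hpow (i : ℕ) : e i ^ 2 ^ i = 1 + ∑ j ∈ Finset.range i, (b * c j) ^ 2 ^ j := by
    induction i with
    | zero => simp [e]
    | succ i ih =>
      rw [pow_succ', pow_mul, he, add_pow_char_pow, ih, Finset.sum_range_succ, add_assoc]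
  have hen : e n = b := by
    have : (e n) ^ 2 ^ n = b ^ 2 ^ n := by rw [hpow, hb]
    exact iterateFrobenius_inj k 2 n this
  refine ⟨∑ i ∈ Finset.range n, (e i + b * c i) • φ^[i] w, ?_⟩
  have hφx : φ (∑ i ∈ Finset.range n, (e i + b * c i) • φ^[i] w) =
      ∑ i ∈ Finset.range n, e (i + 1) • φ^[i + 1] w := by
    rw [map_sum]
    refine Finset.sum_congr rfl fun i _ => ?_
    rw [← he, hφ, Function.iterate_succ_apply']
  have htel : ∑ i ∈ Finset.range n, e (i + 1) • φ^[i + 1] w + w =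
      ∑ i ∈ Finset.range n, e i • φ^[i] w + b • φ^[n] w := by
    rw [← hen, ← Finset.sum_range_succ (fun i => e i • φ^[i] w),
      Finset.sum_range_succ' (fun i => e i • φ^[i] w)]
    simp [e]
  have hx : ∑ i ∈ Finset.range n, (e i + b * c i) • φ^[i] w =
      ∑ i ∈ Finset.range n, e (i + 1) • φ^[i + 1] w + w := by
    rw [htel, ← hc, Finset.smul_sum, ← Finset.sum_add_distrib]
    refine Finset.sum_congr rfl fun i _ => ?_
    rw [add_smul, mul_smul]
  rw [hφx, hx, add_right_comm, two_smul_zero, zero_add]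

end HalfLinear

/-! ### The half-linear derivation attached to a `2`-basis -/

section HalfDeriv

variable {K : Type u} [Field K] [CharP K 2]

namespace IsTwoBasis

/-- The coefficient `b` of `x = a² + b² g`, an additive map which is half-linear for `K`. Its square
is the derivative of `x` with respect to `g`. -/
noncomputable def halfDeriv {g : K} (hg : IsTwoBasis g) : K →+ K where
  toFun x := (hg.2 x).choose_spec.choose
  map_zero' := by
    have h := (hg.2 0).choose_spec.choose_spec
    exact (coord_unique hg.1 (a' := 0) (b' := 0) (h.symm.trans (by simp))).2
  map_add' x y := by
    have hx := (hg.2 x).choose_spec.choose_spec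
    have hy := (hg.2 y).choose_spec.choose_spec
    have hxy := (hg.2 (x + y)).choose_spec.choose_spec
    refine (coord_unique hg.1 (a' := (hg.2 x).choose + (hg.2 y).choose) (hxy.symm.trans ?_)).2
    rw [CharTwo.add_sq, CharTwo.add_sq, add_mul, add_add_add_comm, ← hx, ← hy]

variable {g : K} (hg : IsTwoBasis g)

theorem exists_eq_sq_add_halfDeriv (x : K) : ∃ a, x = a ^ 2 + hg.halfDeriv x ^ 2 * g :=
  ⟨_, (hg.2 x).choose_spec.choose_spec⟩

theorem halfDeriv_eq {x a b : K} (h : x = a ^ 2 + b ^ 2 * g) : hg.halfDeriv x = b := by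
  obtain ⟨a', h'⟩ := hg.exists_eq_sq_add_halfDeriv x
  exact (coord_unique hg.1 (h'.symm.trans h)).2

theorem halfDeriv_sq_mul (c x : K) : hg.halfDeriv (c ^ 2 * x) = c * hg.halfDeriv x := by
  obtain ⟨a, h⟩ := hg.exists_eq_sq_add_halfDeriv x
  refine hg.halfDeriv_eq (a := c * a) ?_
  conv_lhs => rw [h]
  ring

theorem halfDeriv_eq_zero_iff {x : K} : hg.halfDeriv x = 0 ↔ ∃ a, x = a ^ 2 := by
  constructor
  · intro h0
    obtain ⟨a, h⟩ := hg.exists_eq_sq_add_halfDeriv x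
    exact ⟨a, by simpa [h0] using h⟩
  · rintro ⟨a, rfl⟩
    exact hg.halfDeriv_eq (a := a) (by simp)

/-- The change of `2`-basis. -/
theorem halfDeriv_mul_halfDeriv {f : K} (hf : IsTwoBasis f) (x : K) :
    hf.halfDeriv x * hg.halfDeriv f = hg.halfDeriv x := by
  obtain ⟨a, h⟩ := hf.exists_eq_sq_add_halfDeriv x
  conv_rhs => rw [h, map_add, hg.halfDeriv_sq_mul, hg.halfDeriv_eq_zero_iff.2 ⟨a, rfl⟩, zero_add]

end IsTwoBasis

/-- Suppose that all operators `x ↦ D x + m x` are surjective. For a class `z² f` modulo squares,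
look for `g` of the form `r⁴ f + c⁴ f² + f³`: the equation `a(g, f) = z² f` follows from
`r + z (r² + f) = c²`, to which `D` associates the equation `D r + (D z) r = D (z f)`. -/
theorem exists_aInv_eq {f : K} (hf : IsTwoBasis f)
    (hsurj : ∀ m w : K, ∃ x, hf.halfDeriv x + m * x = w) (a : ModSq K) :
    ∃ g : K, ¬ IsSquare g ∧ aInv f g = a := by
  obtain ⟨a, rfl⟩ := ModSq.mk_surjective a
  obtain ⟨y, z, rfl⟩ := hf.2 a
  obtain ⟨r, hr⟩ := hsurj (hf.halfDeriv z) (hf.halfDeriv (z * f))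
  obtain ⟨c, hc⟩ : ∃ c, r + z * (r ^ 2 + f) = c ^ 2 := by
    rw [← hf.halfDeriv_eq_zero_iff, mul_add, map_add, map_add, mul_comm z (r ^ 2),
      hf.halfDeriv_sq_mul, ← add_assoc, mul_comm r, hr, CharTwo.add_self_eq_zero]
  have hrf : r ^ 2 + f ≠ 0 := by
    have := IsTwoBasis.sq_add_sq_mul_ne_zero hf.1 (a := r) (b := 1) (Or.inr one_ne_zero)
    simpa using this
  have hg : ¬ IsSquare ((0 ^ 2 + c ^ 2 * f) ^ 2 + (r ^ 2 + 1 ^ 2 * f) ^ 2 * f) := by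
    rintro ⟨s, hs⟩
    have := IsTwoBasis.coord_unique hf.1 (a' := s) (b' := 0) (hs.trans (by ring))
    exact hrf (by simpa using this.2)
  refine ⟨_, hg, ?_⟩
  rw [aInv_comm hf hg, aInv_eq hf.1 rfl, ModSq.mk_eq_mk_iff]
  refine ⟨y, ?_⟩
  have hc' : c ^ 4 = (r + z * (r ^ 2 + f)) ^ 2 := by rw [hc]; ring
  rw [hc']
  field_simp
  grind

end HalfDeriv

/-! ### Local finiteness of the half-linear derivation of a function field -/

section LocallyFinite

open Polynomial

variable {k : Type*} [Field k] [IsAlgClosed k] [CharP k 2]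
  {K : Type u} [Field K] [CharP K 2] [Algebra k K] [Algebra k[X] K] [IsScalarTower k k[X] K]
  (F : Type*) [Field F] [Algebra k[X] F] [IsFractionRing k[X] F] [Algebra F K]
  [IsScalarTower k[X] F K] [Module.Finite F K] [Algebra.IsSeparable F K]

omit [IsAlgClosed k] [CharP k 2] [CharP K 2] in
theorem algebraMap_smul_polynomial (c : k) (p : k[X]) :
    algebraMap k[X] K (c • p) = c • algebraMap k[X] K p := by
  rw [Algebra.smul_def, map_mul, ← IsScalarTower.algebraMap_apply k k[X] K, ← Algebra.smul_def]

omit [IsAlgClosed k] [CharP k 2] [Algebra k K] [IsScalarTower k k[X] K] in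
include F in
/-- A finite separable extension of `k(T)` has a `k(T)`-basis `E` for which the `q Eᵢ` and a given
element `w` have polynomial coordinates in the bases `E²` and `E`, respectively. -/
theorem exists_polynomial_coord (q w : K) : ∃ (n : ℕ) (E : Fin n → K) (M : Fin n → Fin n → k[X])
    (r : Fin n → k[X]), (∀ i, q * E i = ∑ j, algebraMap k[X] K (M i j) * E j ^ 2) ∧
      w = ∑ i, algebraMap k[X] K (r i) * E i := by
  have : ExpChar F 2 := by
    have : CharP F 2 := (algebraMap F K).charP (algebraMap F K).injective 2
    exact ExpChar.prime Nat.prime_two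
  have : ExpChar K 2 := ExpChar.prime Nat.prime_two
  let e := Module.finBasis F K
  let e' := e.mapPowExpCharPowOfIsSeparable 2 1
  have he' (j) : e' j = e j ^ 2 := by
    simp [e', Module.Basis.mapPowExpCharPowOfIsSeparable]
  obtain ⟨d, hd⟩ := IsLocalization.exist_integer_multiples_of_finite (nonZeroDivisors k[X])
    (Sum.elim (fun ij : _ × _ => e'.repr (q * e ij.1) ij.2) (fun i => e.repr w i))
  choose M hM using fun i j => hd (Sum.inl (i, j))
  choose r hr using fun i => hd (Sum.inr i)
  simp only [Sum.elim_inl, Sum.elim_inr] at hM hr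
  have hd0 : algebraMap k[X] K d ≠ 0 := by
    rw [IsScalarTower.algebraMap_apply k[X] F K]
    simp
  refine ⟨_, fun i => e i / algebraMap k[X] K d, M, r, fun i => ?_, ?_⟩
  · have h := e'.sum_repr (q * e i)
    rw [← mul_div_assoc, ← h, Finset.sum_div]
    refine Finset.sum_congr rfl fun j _ => ?_
    rw [IsScalarTower.algebraMap_apply k[X] F K (M i j), hM, he', Algebra.smul_def,
      Algebra.smul_def, map_mul (algebraMap F K), ← IsScalarTower.algebraMap_apply k[X] F K]
    field_simp
  · have h := e.sum_repr w
    conv_lhs => rw [← h]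
    refine Finset.sum_congr rfl fun j _ => ?_
    rw [IsScalarTower.algebraMap_apply k[X] F K (r j), hr, Algebra.smul_def,
      Algebra.smul_def, map_mul (algebraMap F K), ← IsScalarTower.algebraMap_apply k[X] F K]
    field_simp

variable (hT : IsTwoBasis (algebraMap k[X] K X))

omit [IsAlgClosed k] [CharP k 2] [IsScalarTower k k[X] K] in
theorem halfDeriv_smul (c : k) (x : K) : hT.halfDeriv (c ^ 2 • x) = c • hT.halfDeriv x := by
  rw [Algebra.smul_def, map_pow, hT.halfDeriv_sq_mul, ← Algebra.smul_def]

omit [CharP k 2] in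
/-- The half-linear derivation halves degrees of polynomials. -/
theorem halfDeriv_polynomial_mem {N : ℕ} {p : k[X]} (hp : p.natDegree ≤ 2 * N) :
    hT.halfDeriv (algebraMap k[X] K p) ∈
      Submodule.span k (Set.range fun l : Fin (N + 1) => algebraMap k[X] K X ^ (l : ℕ)) := by
  rw [p.as_sum_range' (2 * N + 1) (by omega), map_sum, map_sum]
  refine sum_mem fun m hm => ?_
  rw [← C_mul_X_pow_eq_monomial, ← smul_eq_C_mul, algebraMap_smul_polynomial]
  obtain ⟨c, hc⟩ := IsAlgClosed.exists_pow_nat_eq (p.coeff m) two_pos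
  rw [← hc, halfDeriv_smul]
  refine Submodule.smul_mem _ _ ?_
  rw [map_pow]
  rcases Nat.even_or_odd' m with ⟨l, rfl | rfl⟩
  · rw [hT.halfDeriv_eq_zero_iff.2 ⟨algebraMap k[X] K X ^ l, by ring⟩]
    exact zero_mem _
  · rw [hT.halfDeriv_eq (a := 0) (b := algebraMap k[X] K X ^ l) (by ring)]
    have := Finset.mem_range.1 hm
    exact Submodule.subset_span ⟨⟨l, by omega⟩, rfl⟩

omit [CharP k 2] in
include F in
theorem exists_halfDeriv_mul_stable (q w : K) : ∃ S : Submodule k K, Module.Finite k S ∧ w ∈ S ∧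
    ∀ x ∈ S, hT.halfDeriv (q * x) ∈ S := by
  obtain ⟨n, E, M, r, hM, hr⟩ := exists_polynomial_coord F q w (k := k)
  obtain ⟨N, hMN, hrN⟩ : ∃ N, (∀ i j, (M i j).natDegree ≤ N) ∧ ∀ i, (r i).natDegree ≤ N := by
    refine ⟨∑ i, ∑ j, (M i j).natDegree + ∑ i, (r i).natDegree, fun i j => ?_, fun i => ?_⟩
    · refine le_trans ?_ (Nat.le_add_right _ _)
      refine le_trans ?_ (Finset.single_le_sum (fun _ _ => Nat.zero_le _) (Finset.mem_univ i))
      exact Finset.single_le_sum (f := fun j => (M i j).natDegree) (fun _ _ => Nat.zero_le _)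
        (Finset.mem_univ j)
    · refine le_trans ?_ (Nat.le_add_left _ _)
      exact Finset.single_le_sum (f := fun i => (r i).natDegree) (fun _ _ => Nat.zero_le _)
        (Finset.mem_univ i)
  let S : Submodule k K := Submodule.span k
    (Set.range fun li : Fin (N + 1) × Fin n => algebraMap k[X] K X ^ (li.1 : ℕ) * E li.2)
  have hS (i : Fin n) {y : K} (hy : y ∈
      Submodule.span k (Set.range fun l : Fin (N + 1) => algebraMap k[X] K X ^ (l : ℕ))) :
      y * E i ∈ S := by
    induction hy using Submodule.span_induction with
    | mem y hy =>
      obtain ⟨l, rfl⟩ := hy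
      exact Submodule.subset_span ⟨(l, i), rfl⟩
    | zero => simp
    | add y z _ _ hy hz => rw [add_mul]; exact add_mem hy hz
    | smul c y _ hy => rw [smul_mul_assoc]; exact S.smul_mem c hy
  refine ⟨S, Module.Finite.span_of_finite k (Set.finite_range _), ?_, fun x hx => ?_⟩
  · rw [hr]
    refine sum_mem fun i _ => hS i ?_
    rw [(r i).as_sum_range' (N + 1) (by have := hrN i; omega), map_sum]
    refine sum_mem fun m hm => ?_
    rw [← C_mul_X_pow_eq_monomial, ← smul_eq_C_mul, algebraMap_smul_polynomial, map_pow]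
    exact Submodule.smul_mem _ _ (Submodule.subset_span ⟨⟨m, Finset.mem_range.1 hm⟩, rfl⟩)
  · induction hx using Submodule.span_induction with
    | mem x hx =>
      obtain ⟨⟨l, i⟩, rfl⟩ := hx
      have h : q * (algebraMap k[X] K X ^ (l : ℕ) * E i) =
          ∑ j, E j ^ 2 * algebraMap k[X] K (X ^ (l : ℕ) * M i j) := by
        rw [mul_left_comm, hM, Finset.mul_sum]
        refine Finset.sum_congr rfl fun j _ => ?_
        rw [map_mul, map_pow]
        ring
      simp only [h, map_sum, hT.halfDeriv_sq_mul]
      refine sum_mem fun j _ => ?_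
      rw [mul_comm]
      refine hS j (halfDeriv_polynomial_mem hT ?_)
      refine natDegree_mul_le.trans ?_
      rw [natDegree_X_pow]
      have := hMN i j
      have := l.2
      omega
    | zero => simp
    | add y z _ _ hy hz => rw [mul_add, map_add]; exact add_mem hy hz
    | smul c y _ hy =>
      obtain ⟨d, rfl⟩ := IsAlgClosed.exists_pow_nat_eq c two_pos
      rw [mul_smul_comm, halfDeriv_smul]
      exact S.smul_mem d hy

include F in
theorem exists_halfDeriv_add_mul_eq (m w : K) : ∃ x, hT.halfDeriv x + m * x = w := by
  by_cases hm : m = 0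
  · exact ⟨w ^ 2 * algebraMap k[X] K X, by
      rw [hm, zero_mul, add_zero]
      exact hT.halfDeriv_eq (a := 0) (by ring)⟩
  obtain ⟨S, hfin, hw, hS⟩ := exists_halfDeriv_mul_stable F hT (m⁻¹ ^ 2) (m⁻¹ * w)
  let φ : S →+ S :=
    { toFun := fun x => ⟨hT.halfDeriv (m⁻¹ ^ 2 * x), hS x x.2⟩
      map_zero' := by ext; simp
      map_add' := fun x y => by ext; simp [mul_add] }
  have hφ (c : k) (x : S) : φ (c ^ 2 • x) = c • φ x := by
    ext
    change hT.halfDeriv (m⁻¹ ^ 2 * (c ^ 2 • (x : K))) = c • hT.halfDeriv (m⁻¹ ^ 2 * (x : K))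
    rw [mul_smul_comm, halfDeriv_smul]
  obtain ⟨x, hx⟩ := exists_add_halfLinear_eq φ hφ ⟨_, hw⟩
  refine ⟨x, ?_⟩
  have h : (x : K) + m⁻¹ * hT.halfDeriv x = m⁻¹ * w := by
    rw [← hT.halfDeriv_sq_mul]
    exact congrArg Subtype.val hx
  field_simp at h
  linear_combination h

include F hT in
theorem exists_halfDeriv_add_mul_eq_of_isTwoBasis {f : K} (hf : IsTwoBasis f) (m w : K) :
    ∃ x, hf.halfDeriv x + m * x = w := by
  have h0 : hT.halfDeriv f ≠ 0 := fun h => by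
    obtain ⟨a, rfl⟩ := hT.halfDeriv_eq_zero_iff.1 h
    exact hf.1 ⟨a, sq a⟩
  obtain ⟨x, hx⟩ := exists_halfDeriv_add_mul_eq F hT (m * hT.halfDeriv f) (w * hT.halfDeriv f)
  refine ⟨x, mul_right_cancel₀ h0 ?_⟩
  rw [← hx, ← hT.halfDeriv_mul_halfDeriv hf x]
  ring

end LocallyFinite

/-! ### Smooth curves over an algebraically closed field -/

section Coordinate

open Polynomial

theorem exists_span_D_eq_top (k A : Type*) [CommRing k] [CommRing A] [Nontrivial A] [Algebra k A]
    [Algebra.IsStandardSmoothOfRelativeDimension 1 k A] :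
    ∃ T : A, Submodule.span A {KaehlerDifferential.D k A T} = ⊤ := by
  obtain ⟨ι, σ, _, _, P, hP⟩ :=
    Algebra.IsStandardSmoothOfRelativeDimension.out (n := 1) (R := k) (S := A)
  have hrank := Algebra.IsStandardSmoothOfRelativeDimension.rank_kaehlerDifferential
    (R := k) (S := A) 1
  have hcard := P.basisKaehler.mk_eq_rank
  rw [hrank, Nat.cast_one, Cardinal.lift_one, Cardinal.lift_eq_one,
    Cardinal.eq_one_iff_unique] at hcard
  obtain ⟨_, ⟨i⟩⟩ := hcard
  refine ⟨P.val i, ?_⟩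
  rw [← P.basisKaehler.span_eq, ← P.basisKaehler_apply]
  congr 1
  ext y
  constructor
  · rintro rfl
    exact ⟨i, rfl⟩
  · rintro ⟨j, rfl⟩
    rw [Subsingleton.elim j i]
    rfl

variable {k : Type*} {A : Type u} [Field k] [CommRing A] [IsDomain A] [Algebra k A]

omit [IsDomain A] in
/-- If `dT` generates the differentials, then `T` is unramified as a map to the affine line. -/
theorem formallyUnramified_polynomial [Algebra k[X] A] [IsScalarTower k k[X] A]
    (hT : Submodule.span A {KaehlerDifferential.D k A (algebraMap k[X] A X)} = ⊤) :
    Algebra.FormallyUnramified k[X] A := by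
  refine ⟨subsingleton_of_forall_eq 0 fun y => ?_⟩
  obtain ⟨z, rfl⟩ := KaehlerDifferential.map_surjective k k[X] A y
  have hz : z ∈ Submodule.span A {KaehlerDifferential.D k A (algebraMap k[X] A X)} := by
    rw [hT]
    trivial
  obtain ⟨a, rfl⟩ := Submodule.mem_span_singleton.1 hz
  rw [map_smul, KaehlerDifferential.map_D]
  simp

variable [Algebra.IsStandardSmoothOfRelativeDimension 1 k A]

include k in
theorem D_ne_zero {T : A} (hT : Submodule.span A {KaehlerDifferential.D k A T} = ⊤) :
    KaehlerDifferential.D k A T ≠ 0 := by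
  intro h0
  have hrank := Algebra.IsStandardSmoothOfRelativeDimension.rank_kaehlerDifferential
    (R := k) (S := A) 1
  rw [h0, Submodule.span_zero_singleton] at hT
  have := (Submodule.subsingleton_iff A).1 (subsingleton_of_bot_eq_top hT)
  simp at hrank

theorem not_isSquare_of_span_D {K : Type*} [Field K] [CharP A 2] [Algebra A K] [IsFractionRing A K]
    {T : A} (hT : Submodule.span A {KaehlerDifferential.D k A T} = ⊤) :
    ¬ IsSquare (algebraMap A K T) := by
  rintro ⟨s, hs⟩
  have := Algebra.IsStandardSmoothOfRelativeDimension.isStandardSmooth (n := 1) (R := k) (S := A)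
  obtain ⟨a, b, hb, rfl⟩ := IsFractionRing.div_surjective (A := A) s
  have hb0 : b ≠ 0 := nonZeroDivisors.ne_zero hb
  have hb0' : algebraMap A K b ≠ 0 := by simpa using hb0
  have h : b ^ 2 * T = a ^ 2 := by
    apply IsFractionRing.injective A K
    rw [map_mul, hs, map_pow, map_pow]
    field_simp
  have hsq (x : A) : KaehlerDifferential.D k A (x ^ 2) = 0 := by
    rw [Derivation.leibniz_pow, ← Nat.cast_smul_eq_nsmul A, Nat.cast_two, CharTwo.two_eq_zero,
      zero_smul]
  have h' := congrArg (KaehlerDifferential.D k A) h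
  rw [Derivation.leibniz, hsq, hsq, smul_zero, add_zero] at h'
  rcases smul_eq_zero.1 h' with h'' | h''
  · exact hb0 (pow_eq_zero_iff two_ne_zero |>.1 h'')
  · exact D_ne_zero hT h''

variable [IsAlgClosed k]

omit [IsAlgClosed k] in
theorem sub_algebraMap_ne_zero {T : A} (hT : Submodule.span A {KaehlerDifferential.D k A T} = ⊤)
    (c : k) : T - algebraMap k A c ≠ 0 := by
  intro h
  apply D_ne_zero hT
  rw [sub_eq_zero.1 h, Derivation.map_algebraMap]

theorem algebraMap_polynomial_injective [Algebra k[X] A] [IsScalarTower k k[X] A]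
    (hT : Submodule.span A {KaehlerDifferential.D k A (algebraMap k[X] A X)} = ⊤) :
    Function.Injective (algebraMap k[X] A) := by
  rw [injective_iff_map_eq_zero]
  intro p hp
  by_contra hp0
  have hroots := (IsAlgClosed.splits p).eq_prod_roots
  rw [hroots, map_mul, mul_eq_zero, map_multiset_prod, Multiset.prod_eq_zero_iff] at hp
  rcases hp with hp | hp
  · rw [← algebraMap_eq, ← IsScalarTower.algebraMap_apply k k[X] A] at hp
    simp [hp0] at hp
  · simp only [Multiset.map_map, Multiset.mem_map, Function.comp_apply, map_sub] at hp
    obtain ⟨c, -, hc⟩ := hp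
    rw [← algebraMap_eq, ← IsScalarTower.algebraMap_apply k k[X] A] at hc
    exact sub_algebraMap_ne_zero hT c hc

variable (K : Type u) [Field K] [Algebra A K] [IsFractionRing A K]

omit [IsDomain A] [Algebra.IsStandardSmoothOfRelativeDimension 1 k A] [IsAlgClosed k] in
/-- The function field is finite and separable over the field of rational functions in `T`. -/
theorem finite_and_isSeparable_functionField [Algebra.FiniteType k A] [Algebra k[X] A]
    [IsScalarTower k k[X] A]
    (hT : Submodule.span A {KaehlerDifferential.D k A (algebraMap k[X] A X)} = ⊤)
    [Algebra k[X] K] [IsScalarTower k[X] A K]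
    (F : Type*) [Field F] [Algebra k[X] F] [IsFractionRing k[X] F] [Algebra F K]
    [IsScalarTower k[X] F K] :
    Module.Finite F K ∧ Algebra.IsSeparable F K := by
  have := formallyUnramified_polynomial hT
  have : Algebra.FormallyUnramified A K := .of_isLocalization (nonZeroDivisors A)
  have : Algebra.FormallyUnramified k[X] K := .comp k[X] A K
  have : Algebra.FormallyUnramified F K := .of_restrictScalars k[X] F K
  have : Algebra.FiniteType k[X] A := .of_restrictScalars_finiteType k k[X] A
  have : Algebra.EssFiniteType A K := .of_isLocalization K (nonZeroDivisors A)
  have : Algebra.EssFiniteType k[X] K := .comp k[X] A K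
  have : Algebra.EssFiniteType F K := .of_comp k[X] F K
  exact ⟨Algebra.FormallyUnramified.finite_of_free F K, Algebra.FormallyUnramified.isSeparable F K⟩

variable {K}

/-- A separable extension `K` of `F = k(T)` is spanned over `F` by squares, and `F = F² + F² T`. -/
theorem exists_eq_sq_add_sq_mul [CharP K 2] [Algebra k[X] K]
    (F : Type*) [Field F] [Algebra k[X] F] [IsFractionRing k[X] F] [Algebra F K]
    [IsScalarTower k[X] F K] [Module.Finite F K] [Algebra.IsSeparable F K] (x : K) :
    ∃ a b, x = a ^ 2 + b ^ 2 * algebraMap k[X] K X := by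
  have : ExpChar F 2 := by
    have : CharP F 2 := (algebraMap F K).charP (algebraMap F K).injective 2
    exact ExpChar.prime Nat.prime_two
  have : ExpChar K 2 := ExpChar.prime Nat.prime_two
  let S : AddSubmonoid K :=
    { carrier := {x | ∃ a b, x = a ^ 2 + b ^ 2 * algebraMap k[X] K X}
      zero_mem' := ⟨0, 0, by simp⟩
      add_mem' := by
        rintro _ _ ⟨a, b, rfl⟩ ⟨c, d, rfl⟩
        refine ⟨a + c, b + d, ?_⟩
        rw [CharTwo.add_sq, CharTwo.add_sq]
        ring }
  have hS (c : K) {x : K} (hx : x ∈ S) : x * c ^ 2 ∈ S := by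
    obtain ⟨a, b, rfl⟩ := hx
    exact ⟨a * c, b * c, by ring⟩
  have hpoly (p : k[X]) : algebraMap k[X] K p ∈ S := by
    induction p using Polynomial.induction_on' with
    | add p q hp hq => rw [map_add]; exact S.add_mem hp hq
    | monomial n c =>
      obtain ⟨d, rfl⟩ := IsAlgClosed.exists_pow_nat_eq c two_pos
      rcases Nat.even_or_odd' n with ⟨l, rfl | rfl⟩
      · refine ⟨algebraMap k[X] K (monomial l d), 0, ?_⟩
        rw [← map_pow, monomial_pow]
        simp [mul_comm]
      · refine ⟨0, algebraMap k[X] K (monomial l d), ?_⟩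
        rw [← map_pow, monomial_pow, ← map_mul, monomial_mul_X]
        simp [mul_comm]
  change x ∈ S
  let e := (Module.finBasis F K).mapPowExpCharPowOfIsSeparable 2 1
  rw [← e.sum_repr x]
  refine S.sum_mem fun i _ => ?_
  have he : e i = Module.finBasis F K i ^ 2 := by
    simp [e, Module.Basis.mapPowExpCharPowOfIsSeparable]
  rw [he, Algebra.smul_def]
  refine hS _ ?_
  obtain ⟨r, s, hs, h⟩ := IsFractionRing.div_surjective (A := k[X]) (e.repr x i)
  have hs0 : algebraMap k[X] K s ≠ 0 := by
    rw [IsScalarTower.algebraMap_apply k[X] F K]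
    simpa using nonZeroDivisors.ne_zero hs
  have h' : algebraMap F K (e.repr x i) =
      algebraMap k[X] K (r * s) * (algebraMap k[X] K s)⁻¹ ^ 2 := by
    rw [← h, map_div₀, ← IsScalarTower.algebraMap_apply, ← IsScalarTower.algebraMap_apply, map_mul]
    field_simp
  rw [h']
  exact hS _ (hpoly _)

variable [CharP k 2] [CharP K 2]

theorem isTwoBasis_and_exists_aInv_eq_of_polynomial [Algebra.FiniteType k A] [Algebra k[X] A]
    [IsScalarTower k k[X] A]
    (hT : Submodule.span A {KaehlerDifferential.D k A (algebraMap k[X] A X)} = ⊤)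
    [Algebra k K] [Algebra k[X] K] [IsScalarTower k[X] A K] [IsScalarTower k k[X] K]
    (F : Type*) [Field F] [Algebra k[X] F] [IsFractionRing k[X] F] [Algebra F K]
    [IsScalarTower k[X] F K] :
    IsTwoBasis (algebraMap k[X] K X) ∧ ∀ (f : K) (a : ModSq K), ¬ IsSquare f →
      ∃ g : K, ¬ IsSquare g ∧ aInv f g = a := by
  obtain ⟨_, _⟩ := finite_and_isSeparable_functionField K hT F
  have _ : CharP A 2 := (algebraMap A K).charP (IsFractionRing.injective A K) 2
  have hTK : IsTwoBasis (algebraMap k[X] K X) := by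
    refine ⟨?_, exists_eq_sq_add_sq_mul F⟩
    rw [IsScalarTower.algebraMap_apply k[X] A K]
    exact not_isSquare_of_span_D (k := k) hT
  refine ⟨hTK, fun f a hf => ?_⟩
  have hf' := hTK.of_not_isSquare hf
  exact exists_aInv_eq hf' (exists_halfDeriv_add_mul_eq_of_isTwoBasis F hTK hf') a

theorem isTwoBasis_and_exists_aInv_eq [Algebra.FiniteType k A] {T : A}
    (hT : Submodule.span A {KaehlerDifferential.D k A T} = ⊤) :
    IsTwoBasis (algebraMap A K T) ∧ ∀ (f : K) (a : ModSq K), ¬ IsSquare f →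
      ∃ g : K, ¬ IsSquare g ∧ aInv f g = a := by
  let _ : Algebra k[X] A := (aeval T).toAlgebra
  have _ : IsScalarTower k k[X] A := IsScalarTower.of_algebraMap_eq' (aeval T).comp_algebraMap.symm
  have hX : algebraMap k[X] A X = T := aeval_X T
  rw [← hX] at hT
  let _ : Algebra k[X] K := ((algebraMap A K).comp (algebraMap k[X] A)).toAlgebra
  have _ : IsScalarTower k[X] A K := IsScalarTower.of_algebraMap_eq' rfl
  let _ : Algebra k K := ((algebraMap A K).comp (algebraMap k A)).toAlgebra
  have _ : IsScalarTower k k[X] K := IsScalarTower.of_algebraMap_eq fun c =>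
    congrArg (algebraMap A K) (aeval_C T c).symm
  have _ : FaithfulSMul k[X] K := (faithfulSMul_iff_algebraMap_injective _ _).2
    ((IsFractionRing.injective A K).comp (algebraMap_polynomial_injective hT))
  let _ : Algebra (FractionRing k[X]) K := FractionRing.liftAlgebra k[X] K
  have _ : IsScalarTower k[X] (FractionRing k[X]) K := FractionRing.isScalarTower_liftAlgebra k[X] K
  have h := isTwoBasis_and_exists_aInv_eq_of_polynomial (K := K) hT (FractionRing k[X])
  rwa [IsScalarTower.algebraMap_apply k[X] A K, hX] at h

end Coordinate

section ClosedPoint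

open Polynomial

variable {k : Type*} {A : Type u} [Field k] [IsAlgClosed k] [CommRing A] [IsDomain A] [Algebra k A]
  [Algebra.IsStandardSmoothOfRelativeDimension 1 k A] [Algebra.FiniteType k A]

/-- At a closed point, where the residue field is `k`, the function `T - c` that vanishes there is a
uniformizer: the quotient of the local ring by it is local and unramified over `k`, hence `k`. -/
theorem exists_uniformizer_sub_const {T : A}
    (hT : Submodule.span A {KaehlerDifferential.D k A T} = ⊤) (P : Ideal A) [P.IsMaximal]
    (R : Type u) [CommRing R] [IsDomain R] [IsLocalRing R] [Algebra A R]
    [IsLocalization.AtPrime R P] :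
    IsDiscreteValuationRing R ∧ (∃ c : k, Irreducible (algebraMap A R (T - algebraMap k A c))) ∧
      ∀ r : R, ∃ c : k, r - algebraMap A R (algebraMap k A c) ∈ IsLocalRing.maximalIdeal R := by
  let _ : Field (A ⧸ P) := Ideal.Quotient.field P
  have : Module.Finite k (A ⧸ P) := finite_of_finite_type_of_isJacobsonRing k (A ⧸ P)
  obtain ⟨c, hc⟩ := (IsAlgClosed.algebraMap_bijective_of_isIntegral (k := k) (K := A ⧸ P)).2
    (Ideal.Quotient.mk P T)
  have hcP : T - algebraMap k A c ∈ P := by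
    rw [← Ideal.Quotient.eq, ← hc]
    rfl
  obtain ⟨t, ht⟩ : ∃ t, t = algebraMap A R (T - algebraMap k A c) := ⟨_, rfl⟩
  have htm : t ∈ IsLocalRing.maximalIdeal R := by
    rw [ht]
    exact (IsLocalization.AtPrime.to_map_mem_maximal_iff R P _).2 hcP
  have hinj : Function.Injective (algebraMap A R) :=
    IsLocalization.injective R P.primeCompl_le_nonZeroDivisors
  have ht0 : t ≠ 0 := by
    rw [ht]
    exact fun h => sub_algebraMap_ne_zero hT c (hinj (h.trans (map_zero _).symm))
  let _ : Algebra k[X] A := (aeval T).toAlgebra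
  have _ : IsScalarTower k k[X] A := IsScalarTower.of_algebraMap_eq' (aeval T).comp_algebraMap.symm
  have hX : algebraMap k[X] A X = T := aeval_X T
  rw [← hX] at hT
  have := formallyUnramified_polynomial hT
  let _ : Algebra k[X] R := ((algebraMap A R).comp (algebraMap k[X] A)).toAlgebra
  have _ : IsScalarTower k[X] A R := IsScalarTower.of_algebraMap_eq' rfl
  let _ : Algebra k R := ((algebraMap A R).comp (algebraMap k A)).toAlgebra
  have _ : IsScalarTower k A R := IsScalarTower.of_algebraMap_eq' rfl
  have : Algebra.FormallyUnramified A R := .of_isLocalization P.primeCompl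
  have : Algebra.FormallyUnramified k[X] R := .comp k[X] A R
  let B := R ⧸ Ideal.span {t}
  have hspan : Ideal.span {t} ≤ IsLocalRing.maximalIdeal R := by
    rwa [Ideal.span_singleton_le_iff_mem]
  have : Nontrivial B := Ideal.Quotient.nontrivial_iff.2 fun h =>
    (IsLocalRing.maximalIdeal.isMaximal R).ne_top (top_le_iff.1 (h ▸ hspan))
  have : IsLocalRing B := .of_surjective' _ Ideal.Quotient.mk_surjective
  -- The structure map of `R / (T - c)` as an algebra over `k[X]` factors through `X ↦ c`.
  let _ : Algebra k[X] k := (aeval c).toAlgebra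
  have : IsScalarTower k[X] k B := IsScalarTower.of_algebraMap_eq' (by
    refine Polynomial.ringHom_ext (fun a => ?_) ?_
    · have h1 : algebraMap k[X] A (C a) = algebraMap k A a := aeval_C T a
      have h2 : algebraMap k[X] k (C a) = a := aeval_C c a
      rw [RingHom.comp_apply, h2, IsScalarTower.algebraMap_apply k[X] R B,
        IsScalarTower.algebraMap_apply k[X] A R, h1]
      rfl
    · have h2 : algebraMap k[X] k X = c := aeval_X c
      rw [RingHom.comp_apply, h2, IsScalarTower.algebraMap_apply k[X] R B,
        IsScalarTower.algebraMap_apply k[X] A R, hX, IsScalarTower.algebraMap_apply k R B,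
        IsScalarTower.algebraMap_apply k A R]
      refine Ideal.Quotient.eq.2 ?_
      rw [← map_sub, ← ht]
      exact Ideal.mem_span_singleton_self t)
  have : Algebra.FormallyUnramified k[X] B := inferInstance
  have : Algebra.FormallyUnramified k B := .of_restrictScalars k[X] k B
  have : Algebra.EssFiniteType A R := .of_isLocalization R P.primeCompl
  have : Algebra.EssFiniteType k R := .comp k A R
  have : Algebra.EssFiniteType k B := .comp k R B
  have hbij := Algebra.FormallyUnramified.bijective_of_isAlgClosed_of_isLocalRing k B
  have hres (r : R) : ∃ c : k, r - algebraMap A R (algebraMap k A c) ∈ Ideal.span {t} := by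
    obtain ⟨d, hd⟩ := hbij.2 (Ideal.Quotient.mk _ r)
    exact ⟨d, Ideal.Quotient.eq.1 hd.symm⟩
  have hmax : IsLocalRing.maximalIdeal R = Ideal.span {t} := by
    refine le_antisymm (fun r hr => ?_) hspan
    obtain ⟨d, hd⟩ := hres r
    have hd' : algebraMap A R (algebraMap k A d) ∈ IsLocalRing.maximalIdeal R := by
      have := sub_mem hr (hspan hd)
      rwa [sub_sub_cancel] at this
    have hd0 : d = 0 := by
      by_contra hd0
      exact (IsLocalRing.mem_maximalIdeal _).1 hd'
        (((isUnit_iff_ne_zero.2 hd0).map (algebraMap k A)).map (algebraMap A R))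
    simpa [hd0] using hd
  have : IsNoetherianRing A := Algebra.FiniteType.isNoetherianRing k A
  have : IsNoetherianRing R := IsLocalization.isNoetherianRing P.primeCompl R inferInstance
  have hfield : ¬ IsField R := by
    rw [IsLocalRing.isField_iff_maximalIdeal_eq, hmax, Ideal.span_singleton_eq_bot]
    exact ht0
  have hdvr : IsDiscreteValuationRing R := by
    refine ((IsDiscreteValuationRing.TFAE R hfield).out 0 4).2 ?_
    exact ⟨⟨t, hmax⟩⟩
  refine ⟨hdvr, ⟨c, ?_⟩, fun r => ?_⟩
  · rw [← ht]
    exact IsDiscreteValuationRing.irreducible_of_span_eq_maximalIdeal t ht0 hmax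
  · obtain ⟨d, hd⟩ := hres r
    exact ⟨d, hspan hd⟩

end ClosedPoint

/-! ### Coordinates on a smooth curve -/

section Curve

variable {k : Type u} [Field k] {X : Scheme.{u}} (p : X ⟶ Spec (.of k))

/-- Around each point of a smooth curve there is an affine open set that is standard smooth of
relative dimension one over `k`, where `k` acts through the structure maps `k → 𝒪_{X,y}`. -/
theorem exists_standardSmooth_chart [SmoothOfRelativeDimension 1 p] (x : X) :
    ∃ U : X.Opens, IsAffineOpen U ∧ x ∈ U ∧ ∃ κ : k →+* Γ(X, U),
      κ.IsStandardSmoothOfRelativeDimension 1 ∧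
      ∀ (y : X) (hy : y ∈ U) (c : k), X.presheaf.germ U y hy (κ c) = constToStalk p y c := by
  obtain ⟨V, hV, U, hU, hxU, e, h⟩ :=
    SmoothOfRelativeDimension.exists_isStandardSmoothOfRelativeDimension (n := 1) (f := p) x
  obtain rfl : V = ⊤ := by
    rw [eq_top_iff]
    intro y _
    have hsub : Subsingleton (Spec (.of k)) := inferInstanceAs (Subsingleton (PrimeSpectrum k))
    rw [Subsingleton.elim y (p x)]
    exact e hxU
  refine ⟨U, hU, hxU, (p.appLE ⊤ U e).hom.comp (Scheme.ΓSpecIso (.of k)).inv.hom, ?_, ?_⟩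
  · exact (RingHom.isStandardSmoothOfRelativeDimension_respectsIso (n := 1)).2 _
      (Scheme.ΓSpecIso (.of k)).symm.commRingCatIsoToRingEquiv h
  · intro y hy c
    have : p.appLE ⊤ U e ≫ X.presheaf.germ U y hy = p.appTop ≫ X.presheaf.germ ⊤ y trivial := by
      rw [Scheme.Hom.appLE, Category.assoc]
      erw [X.presheaf.germ_res]
      rfl
    exact congrArg (fun φ : Γ(Spec (.of k), ⊤) ⟶ X.presheaf.stalk y =>
      φ.hom ((Scheme.ΓSpecIso (.of k)).inv.hom c)) this

variable [IsIntegral X]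

theorem genericPoint_mem {U : X.Opens} {x : X} (hx : x ∈ U) : genericPoint X ∈ U :=
  ((genericPoint_spec X).specializes trivial).mem_open U.isOpen hx

/-- The value of a section in the function field, as the image of its germ at any point. -/
theorem algebraMap_germ_eq {U : X.Opens} {x : X} (hx : x ∈ U) (f : Γ(X, U)) :
    algebraMap (X.presheaf.stalk x) X.functionField (X.presheaf.germ U x hx f) =
      X.presheaf.germ U (genericPoint X) (genericPoint_mem hx) f :=
  have : Nonempty U := ⟨⟨x, hx⟩⟩
  X.algebraMap_germ_eq_germToFunctionField hx f

theorem algebraMap_stalkSpecializes {x y : X} (h : x ⤳ y) (r : X.presheaf.stalk y) :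
    algebraMap (X.presheaf.stalk x) X.functionField (X.presheaf.stalkSpecializes h r) =
      algebraMap (X.presheaf.stalk y) X.functionField r := by
  obtain ⟨U, hU, s, rfl⟩ := X.presheaf.exists_germ_eq r
  rw [TopCat.Presheaf.germ_stalkSpecializes_apply, algebraMap_germ_eq, algebraMap_germ_eq]

omit [IsIntegral X] in
include p in
theorem charP_stalk [CharP k 2] (x : X) : CharP (X.presheaf.stalk x) 2 :=
  charP_of_injective_ringHom (constToStalk p x).injective 2

include p in
theorem charP_functionField [CharP k 2] : CharP X.functionField 2 :=
  charP_stalk p _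

variable [IsAlgClosed k] [CharP k 2] [SmoothOfRelativeDimension 1 p]

/-- Around each point there is a function `T` such that `T - c` is a uniformizer at each nearby
closed point, for a suitable constant `c`; it is a `2`-basis of the function field, and yields the
surjectivity of `a(f, ·)`. At the closed points the constants represent all residue classes. -/
theorem exists_coordinate (x : X) : ∃ (U : X.Opens) (_ : x ∈ U) (T : Γ(X, U)),
    (∀ (η : genericPoint X ∈ U),
      IsTwoBasis (K := X.functionField) (X.presheaf.germ U (genericPoint X) η T)) ∧
    (∀ (f : X.functionField) (a : ModSq X.functionField), ¬ IsSquare f →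
      ∃ g : X.functionField, ¬ IsSquare g ∧ aInv f g = a) ∧
    ∀ (y : X) (hy : y ∈ U), IsClosed {y} → IsDiscreteValuationRing (X.presheaf.stalk y) ∧
      (∃ c : k, Irreducible (X.presheaf.germ U y hy T - constToStalk p y c)) ∧
      ∀ r : X.presheaf.stalk y, ∃ c : k, r - constToStalk p y c ∈ IsLocalRing.maximalIdeal _ := by
  obtain ⟨U, hU, hx, κ, hκ, hconst⟩ := exists_standardSmooth_chart p x
  have hne : Nonempty U := ⟨⟨x, hx⟩⟩
  let _ : Algebra k Γ(X, U) := κ.toAlgebra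
  have _ : Algebra.IsStandardSmoothOfRelativeDimension 1 k Γ(X, U) := hκ
  have _ := Algebra.IsStandardSmoothOfRelativeDimension.isStandardSmooth (n := 1) (R := k)
    (S := Γ(X, U))
  have _ : Algebra.FiniteType k Γ(X, U) := inferInstance
  have _ := functionField_isFractionRing_of_isAffineOpen X U hU
  have _ := charP_functionField p
  obtain ⟨T, hT⟩ := exists_span_D_eq_top k Γ(X, U)
  obtain ⟨h₁, h₂⟩ := isTwoBasis_and_exists_aInv_eq (K := X.functionField) hT
  refine ⟨U, hx, T, fun η => h₁, h₂, fun y hy hcl => ?_⟩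
  have hmax := hU.primeIdealOf_isMaximal_of_isClosed ⟨y, hy⟩ hcl
  let _ := TopCat.Presheaf.algebra_section_stalk X.presheaf (⟨y, hy⟩ : U)
  have hloc := hU.isLocalization_stalk ⟨y, hy⟩
  obtain ⟨hd, ⟨c, hc⟩, hr⟩ := exists_uniformizer_sub_const hT (hU.primeIdealOf ⟨y, hy⟩).asIdeal
    (X.presheaf.stalk y)
  refine ⟨hd, ⟨c, ?_⟩, fun r => ?_⟩
  · rw [← hconst y hy, ← map_sub]
    exact hc
  · obtain ⟨c, hc⟩ := hr r
    refine ⟨c, ?_⟩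
    rw [← hconst y hy]
    exact hc

include p in
theorem isDiscreteValuationRing_stalk {x : X} (hx : IsClosed {x}) :
    IsDiscreteValuationRing (X.presheaf.stalk x) := by
  obtain ⟨U, hxU, T, -, -, h⟩ := exists_coordinate p x
  exact (h x hxU hx).1

/-! ### Pseudo-tameness in terms of the invariant -/

/-- The class `a` modulo squares has a representative that is regular at `x`. -/
def IsRegularModSqAt (x : X) (a : ModSq X.functionField) : Prop :=
  ∃ r : X.presheaf.stalk x, ModSq.mk (algebraMap (X.presheaf.stalk x) X.functionField r) = a

/-- At a closed point, pseudo-tameness of `f` is the regularity modulo squares of `a(f, t)`, where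
`t` is a uniformizer of the form `T - c`. -/
theorem exists_isPseudoTameAt_iff {x : X} (hx : IsClosed {x}) :
    ∃ t : X.functionField, IsTwoBasis t ∧ ∀ f : X.functionField,
      IsPseudoTameAt p f x ↔ ¬ IsSquare f ∧ IsRegularModSqAt x (aInv f t) := by
  obtain ⟨U, hxU, T, hT, -, h⟩ := exists_coordinate p x
  obtain ⟨_, ⟨c, hc⟩, hκ⟩ := h x hxU hx
  have _ := charP_functionField p
  have htb : IsTwoBasis (algebraMap (X.presheaf.stalk x) X.functionField
      (X.presheaf.germ U x hxU T - constToStalk p x c)) := by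
    refine (hT (genericPoint_mem hxU)).of_not_isSquare ?_
    obtain ⟨d, rfl⟩ := IsAlgClosed.exists_pow_nat_eq c two_pos
    rintro ⟨s, hs⟩
    refine (hT (genericPoint_mem hxU)).1
      ⟨s + algebraMap (X.presheaf.stalk x) X.functionField (constToStalk p x d), ?_⟩
    rw [map_sub, map_pow, map_pow, algebraMap_germ_eq hxU] at hs
    grind
  exact ⟨_, htb, exists_uniformizer_pullback_iff (constToStalk p x) hκ hc htb⟩

theorem IsPseudoTameAt.not_isSquare {x : X} (hx : IsClosed {x}) {f : X.functionField}
    (hf : IsPseudoTameAt p f x) : ¬ IsSquare f := by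
  obtain ⟨t, -, h⟩ := exists_isPseudoTameAt_iff p hx
  exact ((h f).1 hf).1

theorem isRegularModSqAt_add [CharP X.functionField 2] {x : X} {a b : ModSq X.functionField}
    (ha : IsRegularModSqAt x a) (hb : IsRegularModSqAt x b) : IsRegularModSqAt x (a + b) := by
  obtain ⟨r, rfl⟩ := ha
  obtain ⟨s, rfl⟩ := hb
  exact ⟨r + s, by rw [map_add, ModSq.mk_add]⟩

/-- The functions that are pseudo-tame at `x` are a single class for the relation that `a(f, g)`
is regular at `x`. -/
theorem IsPseudoTameAt.iff_isRegularModSqAt_aInv {x : X} (hx : IsClosed {x})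
    {f g : X.functionField} (hf : IsPseudoTameAt p f x) (hg : ¬ IsSquare g) :
    IsPseudoTameAt p g x ↔ IsRegularModSqAt x (aInv f g) := by
  have _ := charP_functionField p
  obtain ⟨t, ht, h⟩ := exists_isPseudoTameAt_iff p hx
  obtain ⟨hf', hft⟩ := (h f).1 hf
  have hadd := aInv_add_aInv hf' hg ht
  rw [h g, and_iff_right hg]
  constructor
  · intro hgt
    have := isRegularModSqAt_add hft hgt
    rwa [← hadd, add_assoc, ModSq.add_self, add_zero] at this
  · intro hfg
    have := isRegularModSqAt_add hfg hft
    rwa [← hadd, ← add_assoc, ModSq.add_self, zero_add] at this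

/-- A coordinate is pseudo-tame: `T - c` has order one at the closed points of its domain. -/
theorem nonempty_localData : Nonempty (LocalData p) := by
  choose U hxU T hT _ h using exists_coordinate p
  refine ⟨⟨⟨X, U, fun x => ⟨x, hxU x⟩⟩, fun x => ⟨x, hxU x⟩,
    fun x => X.presheaf.germ (U x) (genericPoint X) (genericPoint_mem (hxU x)) (T x), ?_⟩⟩
  intro x y hy hcl
  obtain ⟨_, ⟨c, hc⟩, -⟩ := h x y hy hcl
  refine ⟨X.presheaf.germ (U x) y hy (T x) - constToStalk p y c, Or.inl ⟨c, ?_, ?_⟩, 0, 1,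
    odd_one, ?_⟩
  · rw [sub_add_cancel]
    exact algebraMap_germ_eq hy _
  · exact (IsLocalRing.mem_maximalIdeal _).2 hc.not_isUnit
  · rw [zero_pow four_ne_zero, add_zero]
    exact (Ring.ord_of_irreducible hc).trans Nat.cast_one.symm

/-! ### Sections of `B_X` as elements of `k(X) / k(X)²` -/

variable [LocallyOfFiniteType p]

omit [IsIntegral X] [IsAlgClosed k] [CharP k 2] [SmoothOfRelativeDimension 1 p] in
include p in
/-- Each point of an open set specializes to a closed point in that set. -/
theorem exists_specializes_isClosed {U : X.Opens} {x : X} (hx : x ∈ U) :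
    ∃ y ∈ U, IsClosed {y} ∧ x ⤳ y := by
  have : JacobsonSpace X := LocallyOfFiniteType.jacobsonSpace p
  obtain ⟨y, ⟨hy₁, hy₂⟩, hy⟩ := nonempty_inter_closedPoints
    (Z := closure {x} ∩ U) ⟨x, subset_closure rfl, hx⟩
    (isClosed_closure.isLocallyClosed.inter U.isOpen.isLocallyClosed)
  exact ⟨y, hy₂, hy, specializes_iff_mem_closure.2 hy₁⟩

include p in
/-- The local rings are normal: if `r ∈ 𝒪_{X,x}` is the square of `z ∈ k(X)`, write `r = a / s` with
`a` and `s` defined near a closed specialization `y` of `x`; then `z s` lies in `𝒪_{X,y}`, since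
its square does. -/
theorem modSqMap_injective (x : X) : Function.Injective
    (ModSq.map (algebraMap (X.presheaf.stalk x) X.functionField)) := by
  have _ := charP_functionField p
  have _ := charP_stalk p x
  rw [injective_iff_map_eq_zero]
  intro a ha
  obtain ⟨r, rfl⟩ := ModSq.mk_surjective a
  rw [ModSq.map_mk, ← ModSq.mk_zero, ModSq.mk_eq_mk_iff] at ha
  rw [← ModSq.mk_zero, ModSq.mk_eq_mk_iff]
  simp only [zero_add] at ha ⊢
  obtain ⟨z, hz⟩ := ha
  obtain ⟨_, ⟨U, hU, rfl⟩, hxU, -⟩ := X.isBasis_affineOpens.exists_subset_of_mem_open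
    (Set.mem_univ x) isOpen_univ
  obtain ⟨y, hyU, hy, hxy⟩ := exists_specializes_isClosed p hxU
  have _ := isDiscreteValuationRing_stalk p hy
  let _ := TopCat.Presheaf.algebra_section_stalk X.presheaf (⟨x, hxU⟩ : U)
  have hloc := IsAffineOpen.isLocalization_stalk hU ⟨x, hxU⟩
  obtain ⟨⟨a, s⟩, has⟩ := IsLocalization.surj
    (M := (IsAffineOpen.primeIdealOf hU ⟨x, hxU⟩).asIdeal.primeCompl) r
  have hs := IsLocalization.map_units (X.presheaf.stalk x) s
  change r * X.presheaf.germ U x hxU s = X.presheaf.germ U x hxU a at has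
  change IsUnit (X.presheaf.germ U x hxU s) at hs
  obtain ⟨w, hw⟩ : ∃ w : X.presheaf.stalk y, algebraMap _ X.functionField w =
      z * algebraMap _ X.functionField (X.presheaf.germ U y hyU s) := by
    refine IsIntegrallyClosed.exists_algebraMap_eq_of_isIntegral_pow two_pos ?_
    have : (z * algebraMap _ X.functionField (X.presheaf.germ U y hyU s)) ^ 2 =
        algebraMap _ X.functionField (X.presheaf.germ U y hyU (a * s)) := by
      rw [mul_pow, ← hz, map_mul, map_mul, algebraMap_germ_eq, algebraMap_germ_eq,
        ← algebraMap_germ_eq hxU a, ← algebraMap_germ_eq hxU s.1, ← has, map_mul]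
      ring
    rw [this]
    exact isIntegral_algebraMap
  refine ⟨X.presheaf.stalkSpecializes hxy w * hs.unit⁻¹.1, ?_⟩
  apply IsFractionRing.injective (X.presheaf.stalk x) X.functionField
  rw [hz, map_pow, map_mul, algebraMap_stalkSpecializes, hw, algebraMap_germ_eq,
    ← algebraMap_germ_eq hxU, mul_assoc, ← map_mul]
  simp

include p in
theorem HasGenericValue.ext {U : X.Opens} {s s' : (BX X).obj (op U)} {a : ModSq X.functionField}
    (h : HasGenericValue X s a) (h' : HasGenericValue X s' a) : s = s' := by
  refine Subtype.ext (funext fun x => modSqMap_injective p x.1 ?_)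
  exact (h x).trans (h' x).symm

omit [LocallyOfFiniteType p] in
theorem isRegularModSqAt_of_hasGenericValue {U : X.Opens} {s : (BX X).obj (op U)}
    {a : ModSq X.functionField} (h : HasGenericValue X s a) {x : X} (hx : x ∈ U) :
    IsRegularModSqAt x a := by
  obtain ⟨r, hr⟩ := ModSq.mk_surjective ((show bSections X U from s).1 ⟨x, hx⟩)
  exact ⟨r, by rw [← h ⟨x, hx⟩, ← hr, ModSq.map_mk]⟩

include p in
/-- A class modulo squares that is regular at all closed points of `U` is a section of `B_X`. -/
theorem exists_hasGenericValue (U : X.Opens) (a : ModSq X.functionField)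
    (ha : ∀ x ∈ U, IsClosed {x} → IsRegularModSqAt x a) :
    ∃ s : (BX X).obj (op U), HasGenericValue X s a := by
  have hall (x : U) : IsRegularModSqAt x.1 a := by
    obtain ⟨y, hyU, hy, hxy⟩ := exists_specializes_isClosed p x.2
    obtain ⟨r, hr⟩ := ha y hyU hy
    exact ⟨X.presheaf.stalkSpecializes hxy r, by rw [algebraMap_stalkSpecializes, hr]⟩
  choose r hr using hall
  refine ⟨⟨fun x => ModSq.mk (r x), fun x => ?_⟩, fun x => hr x⟩
  obtain ⟨V, hxV, h, hh⟩ := X.presheaf.exists_germ_eq (r x)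
  refine ⟨V ⊓ U, inf_le_right, ⟨hxV, x.2⟩, X.presheaf.map (homOfLE inf_le_left).op h,
    fun y hy => modSqMap_injective p y ?_⟩
  rw [TopCat.Presheaf.germ_res_apply]
  change ModSq.mk (algebraMap _ _ (r ⟨y, hy.2⟩)) = ModSq.mk (algebraMap _ _ _)
  rw [hr, ← hr x, ← hh, algebraMap_germ_eq, algebraMap_germ_eq]

omit [IsAlgClosed k] [CharP k 2] [SmoothOfRelativeDimension 1 p] [LocallyOfFiniteType p] in
/-- On a nonempty open set, the germ of a section of `B_X` at the generic point determines the
others. -/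
theorem exists_hasGenericValue_of_mem {U : X.Opens} {x : X} (hx : x ∈ U)
    (s : (BX X).obj (op U)) : ∃ a, HasGenericValue X s a := by
  have hη := genericPoint_mem hx
  refine ⟨(show bSections X U from s).1 ⟨genericPoint X, hη⟩, fun y => ?_⟩
  obtain ⟨V, hVU, hyV, h, hh⟩ := s.2 y
  refine (congrArg _ (hh y hyV)).trans (Eq.trans ?_ (hh _ (genericPoint_mem hyV)).symm)
  rw [ModSq.map_mk, algebraMap_germ_eq]

section

omit [IsAlgClosed k] [CharP k 2] [SmoothOfRelativeDimension 1 p] [LocallyOfFiniteType p]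

theorem HasGenericValue.add {U : X.Opens} {s s' : (BX X).obj (op U)}
    {a a' : ModSq X.functionField} (h : HasGenericValue X s a) (h' : HasGenericValue X s' a') :
    HasGenericValue X (s + s') (a + a') := fun x =>
  (map_add _ _ _).trans (congrArg₂ (· + ·) (h x) (h' x))

theorem HasGenericValue.sub {U : X.Opens} {s s' : (BX X).obj (op U)}
    {a a' : ModSq X.functionField} (h : HasGenericValue X s a) (h' : HasGenericValue X s' a') :
    HasGenericValue X (s - s') (a - a') := fun x =>
  (map_sub _ _ _).trans (congrArg₂ (· - ·) (h x) (h' x))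

theorem hasGenericValue_zero {U : X.Opens} : HasGenericValue X (0 : (BX X).obj (op U)) 0 :=
  fun _ => map_zero _

theorem HasGenericValue.res {U V : X.Opens} (hVU : V ≤ U) {s : (BX X).obj (op U)}
    {a : ModSq X.functionField} (h : HasGenericValue X s a) :
    HasGenericValue X (PseudoTame.res (BX X) hVU s) a := fun x =>
  h ⟨x.1, hVU x.2⟩

theorem HasGenericValue.unique {U : X.Opens} {s : (BX X).obj (op U)}
    {a a' : ModSq X.functionField} (h : HasGenericValue X s a) (h' : HasGenericValue X s a')
    {x : X} (hx : x ∈ U) : a = a' :=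
  (h ⟨x, hx⟩).symm.trans (h' ⟨x, hx⟩)

end

end Curve

/-! ### Classes in `H¹` -/

section H1

variable {X : TopCat.{u}} (F : TopCat.Presheaf AddCommGrpCat.{u} X)

theorem H1.mk_refineCocycles {U V : Covering X} (φ : V.I → U.I) (hφ : U.IsRefinement V φ)
    (s : cocycles F U) : H1.mk F V (refineCocycles F φ hφ s) = H1.mk F U s := by
  have h : U ≤ V := ⟨φ, hφ⟩
  refine Eq.trans ?_ (DirectLimit.eq_of_le (f := transition F) ⟨U, QuotientAddGroup.mk s⟩ V h).symm
  change _ = (⟦⟨V, transition F U V h (QuotientAddGroup.mk s)⟩⟧ : H1 F)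
  rw [transition_eq F h φ hφ]
  rfl

theorem H1.mk_eq_zero_iff {U : Covering X} (s : cocycles F U) :
    H1.mk F U s = 0 ↔ ∃ (V : Covering X) (φ : V.I → U.I) (hφ : U.IsRefinement V φ)
      (t : ∀ j, F.obj (op (V.U j))), coboundary F V t = refineCocycles F φ hφ s := by
  refine (DirectLimit.exists_eq_zero (f := transition F) _).trans ?_
  constructor
  · rintro ⟨V, ⟨φ, hφ⟩, h⟩
    rw [transition_eq F _ φ hφ] at h
    obtain ⟨t, ht⟩ := (QuotientAddGroup.eq_zero_iff _).1 h
    exact ⟨V, φ, hφ, t, ht⟩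
  · rintro ⟨V, φ, hφ, t, ht⟩
    refine ⟨V, ⟨φ, hφ⟩, ?_⟩
    rw [transition_eq F _ φ hφ]
    exact (QuotientAddGroup.eq_zero_iff _).2 ⟨t, ht⟩

end H1

/-! ### The obstruction class -/

section Obstruction

variable {k : Type u} [Field k] [IsAlgClosed k] [CharP k 2] {X : Scheme.{u}}
  (p : X ⟶ Spec (.of k)) [IsIntegral X] [SmoothOfRelativeDimension 1 p] [LocallyOfFiniteType p]

namespace LocalData

variable {p} (D : LocalData p)

theorem not_isSquare (i : D.cover.I) : ¬ IsSquare (D.f i) := by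
  obtain ⟨x, hx⟩ := D.nonempty i
  obtain ⟨y, hyU, hy, -⟩ := exists_specializes_isClosed p hx
  exact (D.isPseudoTameOn i y hyU hy).not_isSquare p hy

theorem aInv_add_aInv (i j l : D.cover.I) :
    aInv (D.f i) (D.f j) + aInv (D.f j) (D.f l) = aInv (D.f i) (D.f l) := by
  have _ := charP_functionField p
  obtain ⟨x, hx⟩ := D.nonempty i
  obtain ⟨y, -, hy, -⟩ := exists_specializes_isClosed p hx
  obtain ⟨t, ht, -⟩ := exists_isPseudoTameAt_iff p hy
  exact PseudoTame.aInv_add_aInv (D.not_isSquare i) (D.not_isSquare j)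
    (ht.of_not_isSquare (D.not_isSquare l))

theorem exists_cocycle : ∃ s : cocycles (BX X) D.cover,
    ∀ i j, HasGenericValue X (s.1 i j) (aInv (D.f i) (D.f j)) := by
  have h (i j : D.cover.I) : ∃ s : (BX X).obj (op (D.cover.U i ⊓ D.cover.U j)),
      HasGenericValue X s (aInv (D.f i) (D.f j)) := by
    refine exists_hasGenericValue p _ _ fun x hx hcl => ?_
    exact ((D.isPseudoTameOn i x hx.1 hcl).iff_isRegularModSqAt_aInv p hcl
      (D.not_isSquare j)).1 (D.isPseudoTameOn j x hx.2 hcl)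
  choose s hs using h
  refine ⟨⟨s, fun i j l => ?_⟩, hs⟩
  refine HasGenericValue.ext p ((((hs j l).res _).sub ((hs i l).res _)).add ((hs i j).res _)) ?_
  rw [← D.aInv_add_aInv i j l, show ∀ a b : ModSq X.functionField, a - (b + a) + b = 0 by
    intros; abel]
  exact hasGenericValue_zero

theorem exists_isClass : ∃ b, D.IsClass b := by
  obtain ⟨s, hs⟩ := D.exists_cocycle
  exact ⟨_, s, hs, rfl⟩

/-- The disjoint union of two local data. -/
def sum (D D' : LocalData p) : LocalData p where
  cover :=
    { I := D.cover.I ⊕ D'.cover.I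
      U := Sum.elim D.cover.U D'.cover.U
      exists_mem := fun x =>
        let ⟨i, hi⟩ := D.cover.exists_mem x
        ⟨Sum.inl i, hi⟩ }
  nonempty := by
    rintro (i | i)
    · exact D.nonempty i
    · exact D'.nonempty i
  f := Sum.elim D.f D'.f
  isPseudoTameOn := by
    rintro (i | i)
    · exact D.isPseudoTameOn i
    · exact D'.isPseudoTameOn i

/-- The pull-back of the cocycle of one local datum to a covering refining it represents the class
of any local datum with this covering and the corresponding functions. -/
theorem IsClass.eq_mk_of_refinement {D E : LocalData p} {b : H1 (BX X)} (hb : D.IsClass b)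
    (φ : D.cover.I → E.cover.I) (hφ : E.cover.IsRefinement D.cover φ)
    (hf : ∀ i, E.f (φ i) = D.f i) {s : cocycles (BX X) E.cover}
    (hs : ∀ i j, HasGenericValue X (s.1 i j) (aInv (E.f i) (E.f j))) :
    b = H1.mk (BX X) E.cover s := by
  obtain ⟨t, ht, rfl⟩ := hb
  rw [← H1.mk_refineCocycles (BX X) φ hφ s]
  congr 1
  ext i j : 3
  refine HasGenericValue.ext p (ht i j) ?_
  rw [← hf i, ← hf j]
  exact (hs (φ i) (φ j)).res _

/-- Two local data have the same class, since both are refined by their disjoint union in such a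
way that the functions correspond. -/
theorem IsClass.unique {D D' : LocalData p} {b b' : H1 (BX X)} (hb : D.IsClass b)
    (hb' : D'.IsClass b') : b = b' := by
  obtain ⟨s, hs⟩ := (D.sum D').exists_cocycle
  exact (hb.eq_mk_of_refinement Sum.inl (fun _ => le_rfl) (fun _ => rfl) hs).trans
    (hb'.eq_mk_of_refinement Sum.inr (fun _ => le_rfl) (fun _ => rfl) hs).symm

theorem isClass_beta : D.IsClass (beta p) := by
  have h : ∃ (b : H1 (BX X)) (D : LocalData p), D.IsClass b :=
    ⟨_, D, D.exists_isClass.choose_spec⟩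
  have hbeta : beta p = h.choose := dif_pos h
  obtain ⟨D', hD'⟩ := h.choose_spec
  obtain ⟨b, hb⟩ := D.exists_isClass
  rw [hbeta, hD'.unique hb]
  exact hb

theorem isClass_iff (b : H1 (BX X)) : D.IsClass b ↔ b = beta p := by
  constructor
  · exact fun hb => hb.unique D.isClass_beta
  · rintro rfl
    exact D.isClass_beta

end LocalData

omit [LocallyOfFiniteType p] in
include p in
theorem exists_aInv_eq_functionField (f : X.functionField) (a : ModSq X.functionField)
    (hf : ¬ IsSquare f) : ∃ g : X.functionField, ¬ IsSquare g ∧ aInv f g = a := by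
  obtain ⟨U, hU, T, -, h, -⟩ := exists_coordinate p (genericPoint X)
  exact h f a hf

/-- If the pull-back of the cocycle `a(fᵢ, fⱼ)` to a refinement is the coboundary of sections with
generic values `aᵢ`, a function `g` with `a(f₀, g) = a₀` has `a(fᵢ, g) = aᵢ` for all `i`,
since signs do not matter modulo squares, so it is pseudo-tame everywhere. -/
theorem exists_isPseudoTameOn_of_beta_eq_zero (h0 : beta p = 0) :
    ∃ f : X.functionField, IsPseudoTameOn p f ⊤ := by
  have _ := charP_functionField p
  obtain ⟨D⟩ := nonempty_localData p
  obtain ⟨s, hs, hsb⟩ := D.isClass_beta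
  obtain ⟨V, φ, hφ, t, ht⟩ := (H1.mk_eq_zero_iff (BX X) s).1 (hsb.symm.trans h0)
  obtain ⟨i₀, hi₀⟩ := V.exists_mem (genericPoint X)
  obtain ⟨a₀, ha₀⟩ := exists_hasGenericValue_of_mem hi₀ (t i₀)
  obtain ⟨g, hg, hga⟩ := exists_aInv_eq_functionField p (D.f (φ i₀)) a₀ (D.not_isSquare _)
  refine ⟨g, fun x _ hx => ?_⟩
  obtain ⟨i, hi⟩ := V.exists_mem x
  obtain ⟨a, ha⟩ := exists_hasGenericValue_of_mem hi (t i)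
  rw [(D.isPseudoTameOn (φ i) x (hφ i hi) hx).iff_isRegularModSqAt_aInv p hx hg]
  obtain ⟨u, hu, -⟩ := exists_isPseudoTameAt_iff p hx
  have hcocycle : aInv (D.f (φ i)) (D.f (φ i₀)) = a₀ - a := by
    have h₁ : HasGenericValue X ((coboundary (BX X) V t).1 i i₀) (a₀ - a) :=
      (ha₀.res inf_le_right).sub (ha.res inf_le_left)
    rw [ht] at h₁
    exact HasGenericValue.unique ((hs (φ i) (φ i₀)).res _) h₁
      (⟨genericPoint_mem hi, hi₀⟩ : genericPoint X ∈ V.U i ⊓ V.U i₀)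
  have hadd := aInv_add_aInv (D.not_isSquare (φ i)) (D.not_isSquare (φ i₀)) (hu.of_not_isSquare hg)
  rw [← hadd, hcocycle, hga, sub_add_eq_add_sub, ModSq.add_self, zero_sub, ModSq.neg_eq]
  exact isRegularModSqAt_of_hasGenericValue ha hi

/-- A function that is pseudo-tame everywhere is a local datum on the covering by `X` alone, with
cocycle `a(f, f) = 0`. -/
theorem beta_eq_zero_of_isPseudoTameOn {f : X.functionField} (hf : IsPseudoTameOn p f ⊤) :
    beta p = 0 := by
  have _ := charP_functionField p
  let D : LocalData p :=
    { cover := ⟨PUnit, fun _ => ⊤, fun _ => ⟨⟨⟩, trivial⟩⟩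
      nonempty := fun _ => ⟨genericPoint X, trivial⟩
      f := fun _ => f
      isPseudoTameOn := fun _ => hf }
  obtain ⟨s, hs, hsb⟩ := D.isClass_beta
  have hs0 : s = 0 := by
    ext i j : 3
    refine HasGenericValue.ext p (hs i j) ?_
    rw [aInv_self (D.not_isSquare i)]
    exact hasGenericValue_zero
  rw [hsb, hs0]
  exact (H1.mk_eq_zero_iff (BX X) _).2 ⟨_, id, fun _ => le_rfl, 0, by rw [map_zero, map_zero]⟩

end Obstruction
end PseudoTame

theorem mainTheorem4 {k : Type u} [Field k] [IsAlgClosed k] [CharP k 2]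
    (X : Scheme.{u}) (p : X ⟶ Spec (.of k)) [IsIntegral X] [IsProper p]
    [SmoothOfRelativeDimension 1 p] :
    -- the class `β(X)` is well-defined: local data exist, and all of them have the class `β(X)`
    (Nonempty (PseudoTame.LocalData p) ∧
      ∀ (D : PseudoTame.LocalData p) (b : PseudoTame.H1 (PseudoTame.BX X)),
        D.IsClass b ↔ b = PseudoTame.beta p) ∧
    -- it is the obstruction to the existence of a pseudo-tame rational function
    (PseudoTame.beta p = 0 ↔ ∃ f : X.functionField, PseudoTame.IsPseudoTameOn p f ⊤) ∧
    -- the values of the invariant `a(f, ·)`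
    (∀ (f : X.functionField) (a : PseudoTame.ModSq X.functionField), ¬ IsSquare f →
      ∃ g : X.functionField, ¬ IsSquare g ∧ PseudoTame.aInv f g = a) :=
  ⟨⟨PseudoTame.nonempty_localData p, fun D b => D.isClass_iff b⟩,
    ⟨PseudoTame.exists_isPseudoTameOn_of_beta_eq_zero p,
      fun ⟨_, hf⟩ => PseudoTame.beta_eq_zero_of_isPseudoTameOn p hf⟩,
    PseudoTame.exists_aInv_eq_functionField p⟩
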